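/- Let $R$ be a nearly simple uniserial domain: a (noncommutative) domain whose left ideals form a chain and whose right ideals form a chain, and whose only two-sided ideal different from $0$ and $R$ is its Jacobson radical $J(R)$. Let $X_R$ be a right $R$-module isomorphic to $R/aR$ for some $0\neq a\in J(R)$, and let $S=\operatorname{End}_R X$ (a Dubrovin–Puninski ring), acting on $X$ from the left. Let $I\subseteq S$ be the ideal of non-monomorphisms, $K\subseteq S$ the ideal of non-epimorphisms, and $J=I\cap K$. All $S$-modules below are left modules. A submodule $N\subseteq M$ is pure if every morphism from a finitely presented module to $M/N$ lifts to $M$; a module $M$ is absolutely pure if $\operatorname{Ext}^1_S(G,M)=0$ for every finitely presented $G$; a module is uniserial if its submodules form a chain. A morphism $m:A\to B$ of $S$-modules is left almost split if it is not a split monomorphism and every morphism $A\to M$ that is not a split monomorphism factors through $m$; it is moreover minimal if every endomorphism $t$ of $B$ with $tm=m$ is an automorphism. Right almost split morphisms are defined dually, and a short exact sequence $0\to A\xrightarrow{i}B\xrightarrow{p}C\to 0$ is almost split if $i$ is left almost split and $p$ is right almost split. (1) There is a short exact sequence $0\to X\xrightarrow{f}X\xrightarrow{g}X\to 0$ of right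 $R$-modules. For every such $f,g\in S$ there is a countably generated left ideal $I_\omega$ with $Sg\subseteq I_\omega\subseteq I$ which is pure as a submodule of ${}_SI$ and satisfies $I_\omega f=J_\omega$ and $J_\omega f=J_\omega$, where $J_\omega=I_\omega\cap J$. (2) For all $f,g,I_\omega$ as in (1), the left $S$-module $I_\omega/Ig$ is absolutely pure, flat and uniserial. The map $s_\omega:S/I\to I_\omega/Ig$, $x+I\mapsto xg+Ig$, is a monomorphism whose image is the socle of $I_\omega/Ig$, and $s_\omega$ is left almost split in the category $S\text{-}\mathrm{Mod}$ of all left $S$-modules. (3) The left $S$-module $S/I$ is simple and not injective. There is no minimal left almost split morphism in $S\text{-}\mathrm{Mod}$ with domain $S/I$, and there is no almost split sequence $0\to S/I\to B\to C\to 0$ in $S\text{-}\mathrm{Mod}$. -/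

import Mathlib

open scoped TensorProduct
open MulOpposite (op)

universe u v w

namespace DubrovinPuninski

/-! ### General notions for left modules over an arbitrary ring -/

section Modules

variable (S : Type u) [Ring S]

/-- A module is uniserial if its submodules form a chain. -/
def IsUniserial (M : Type v) [AddCommGroup M] [Module S M] : Prop :=
  ∀ N P : Submodule S M, N ≤ P ∨ P ≤ N

/-- The socle: the sum of all simple submodules. -/
def socle (M : Type v) [AddCommGroup M] [Module S M] : Submodule S M :=
  sSup {N : Submodule S M | IsSimpleModule S N}

variable {S} in
/-- A submodule `N` of `M` is pure if every morphism from a finitely presented module to `M ⧸ N`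
lifts to `M`. -/
def IsPure {M : Type u} [AddCommGroup M] [Module S M] (N : Submodule S M) : Prop :=
  ∀ (G : Type u) [AddCommGroup G] [Module S G], Module.FinitePresentation S G →
    ∀ h : G →ₗ[S] M ⧸ N, ∃ k : G →ₗ[S] M, N.mkQ ∘ₗ k = h

/-- `M` is absolutely pure if `Ext¹(G, M) = 0` for every finitely presented module `G`. -/
def IsAbsolutelyPure (M : Type u) [AddCommGroup M] [Module S M] : Prop :=
  haveI : CategoryTheory.HasExt.{u} (ModuleCat.{u} S) :=
    CategoryTheory.hasExt_of_enoughProjectives (ModuleCat.{u} S)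
  ∀ (G : Type u) [AddCommGroup G] [Module S G], Module.FinitePresentation S G →
    Subsingleton (CategoryTheory.Abelian.Ext (ModuleCat.of S G) (ModuleCat.of S M) 1)

/-- The relations `n s ⊗ m = n ⊗ s m` in `N ⊗ M` (over the integers), for a right module `N` and a
left module `M`. -/
def balancedRel (N : Type v) [AddCommGroup N] [Module Sᵐᵒᵖ N]
    (M : Type w) [AddCommGroup M] [Module S M] : Submodule ℤ (N ⊗[ℤ] M) :=
  Submodule.span ℤ {t | ∃ (n : N) (s : S) (m : M), t = (op s • n) ⊗ₜ[ℤ] m - n ⊗ₜ[ℤ] (s • m)}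

/-- The tensor product of a right module and a left module over a (noncommutative) ring. -/
abbrev BalancedTensor (N : Type v) [AddCommGroup N] [Module Sᵐᵒᵖ N]
    (M : Type w) [AddCommGroup M] [Module S M] : Type (max v w) :=
  (N ⊗[ℤ] M) ⧸ balancedRel S N M

theorem balancedRel_le_comap {N N' : Type v} [AddCommGroup N] [Module Sᵐᵒᵖ N]
    [AddCommGroup N'] [Module Sᵐᵒᵖ N'] (φ : N →ₗ[Sᵐᵒᵖ] N')
    (M : Type w) [AddCommGroup M] [Module S M] :
    balancedRel S N M ≤
      (balancedRel S N' M).comap (LinearMap.rTensor M φ.toAddMonoidHom.toIntLinearMap) := by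
  refine Submodule.span_le.2 ?_
  rintro _ ⟨n, s, m, rfl⟩
  refine Submodule.subset_span ⟨φ n, s, m, ?_⟩
  simp

/-- The map `φ ⊗ M` induced by a morphism `φ` of right modules. -/
def balancedMap {N N' : Type v} [AddCommGroup N] [Module Sᵐᵒᵖ N]
    [AddCommGroup N'] [Module Sᵐᵒᵖ N'] (φ : N →ₗ[Sᵐᵒᵖ] N')
    (M : Type w) [AddCommGroup M] [Module S M] :
    BalancedTensor S N M →ₗ[ℤ] BalancedTensor S N' M :=
  Submodule.mapQ _ _ (LinearMap.rTensor M φ.toAddMonoidHom.toIntLinearMap)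
    (balancedRel_le_comap S φ M)

/-- A left module is flat if tensoring with it preserves monomorphisms of right modules. -/
def IsFlat (M : Type v) [AddCommGroup M] [Module S M] : Prop :=
  ∀ (N N' : Type u) [AddCommGroup N] [Module Sᵐᵒᵖ N] [AddCommGroup N'] [Module Sᵐᵒᵖ N']
    (φ : N →ₗ[Sᵐᵒᵖ] N'), Function.Injective φ → Function.Injective (balancedMap S φ M)

variable {S}

/-- Split monomorphisms. -/
def IsSplitMono {A B : Type v} [AddCommGroup A] [Module S A] [AddCommGroup B] [Module S B]
    (m : A →ₗ[S] B) : Prop :=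
  ∃ r : B →ₗ[S] A, r ∘ₗ m = LinearMap.id

/-- Split epimorphisms. -/
def IsSplitEpi {A B : Type v} [AddCommGroup A] [Module S A] [AddCommGroup B] [Module S B]
    (p : A →ₗ[S] B) : Prop :=
  ∃ r : B →ₗ[S] A, p ∘ₗ r = LinearMap.id

/-- Left almost split morphisms in the category of all left modules. -/
def IsLeftAlmostSplit {A B : Type v} [AddCommGroup A] [Module S A] [AddCommGroup B] [Module S B]
    (m : A →ₗ[S] B) : Prop :=
  ¬ IsSplitMono m ∧
    ∀ (M : Type v) [AddCommGroup M] [Module S M] (q : A →ₗ[S] M), ¬ IsSplitMono q →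
      ∃ k : B →ₗ[S] M, k ∘ₗ m = q

/-- Right almost split morphisms in the category of all left modules. -/
def IsRightAlmostSplit {A B : Type v} [AddCommGroup A] [Module S A] [AddCommGroup B] [Module S B]
    (p : A →ₗ[S] B) : Prop :=
  ¬ IsSplitEpi p ∧
    ∀ (M : Type v) [AddCommGroup M] [Module S M] (q : M →ₗ[S] B), ¬ IsSplitEpi q →
      ∃ k : M →ₗ[S] A, p ∘ₗ k = q

/-- A left almost split morphism `m : A → B` is minimal if every endomorphism `t` of `B` with
`t m = m` is an automorphism. -/
def IsMinimalLeftAlmostSplit {A B : Type v} [AddCommGroup A] [Module S A]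
    [AddCommGroup B] [Module S B] (m : A →ₗ[S] B) : Prop :=
  IsLeftAlmostSplit m ∧ ∀ t : B →ₗ[S] B, t ∘ₗ m = m → Function.Bijective t

/-- A short exact sequence `0 → A → B → C → 0` is almost split if its monomorphism is left almost
split and its epimorphism is right almost split. -/
def IsAlmostSplitSequence {A B C : Type v} [AddCommGroup A] [Module S A]
    [AddCommGroup B] [Module S B] [AddCommGroup C] [Module S C]
    (i : A →ₗ[S] B) (p : B →ₗ[S] C) : Prop :=
  Function.Injective i ∧ Function.Exact i p ∧ Function.Surjective p ∧
    IsLeftAlmostSplit i ∧ IsRightAlmostSplit p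

/-- Right multiplication by `x`, an endomorphism of the left module `S`. -/
def rightMul (x : S) : S →ₗ[S] S :=
  LinearMap.toSpanSingleton S S x

/-- The map `s : S / I → L / I g`, `x + I ↦ x g + I g`, where `L` is a left ideal containing `g`. -/
def pushoutMap (I L : Ideal S) (g : S) (hg : g ∈ L) :
    (S ⧸ I) →ₗ[S] (L ⧸ (Submodule.map (rightMul g) I).submoduleOf L) :=
  Submodule.mapQ I ((Submodule.map (rightMul g) I).submoduleOf L)
    (LinearMap.toSpanSingleton S L ⟨g, hg⟩)
    (fun x hx => ⟨x, hx, rfl⟩)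

end Modules

/-! ### Nearly simple uniserial domains -/

/-- A (not necessarily commutative) domain, uniserial on both sides, whose only nontrivial
two-sided ideal is the Jacobson radical. -/
structure IsNearlySimpleUniserialDomain (R : Type u) [Ring R] : Prop where
  isDomain : IsDomain R
  uniserial_left : IsUniserial R R
  uniserial_right : IsUniserial Rᵐᵒᵖ R
  twoSided_iff : ∀ A : Ideal R, A.IsTwoSided → ((A ≠ ⊥ ∧ A ≠ ⊤) ↔ A = Ring.jacobson R)

/-- The right ideal `a R`; right modules are modules over the opposite ring. -/
def principalRightIdeal {R : Type u} [Ring R] (a : R) : Submodule Rᵐᵒᵖ R :=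
  Submodule.span Rᵐᵒᵖ {a}

/-- `X` is (isomorphic to) `R / a R` for some nonzero `a` in the Jacobson radical. -/
def IsCyclicallyPresentedTorsion (R : Type u) [Ring R] (X : Type v) [AddCommGroup X]
    [Module Rᵐᵒᵖ X] : Prop :=
  ∃ a : R, a ∈ Ring.jacobson R ∧ a ≠ 0 ∧ Nonempty (X ≃ₗ[Rᵐᵒᵖ] (R ⧸ principalRightIdeal a))

section Ideals

variable {R : Type u} [Ring R] {X : Type v} [AddCommGroup X] [Module Rᵐᵒᵖ X]

theorem IsCyclicallyPresentedTorsion.nontrivial (hX : IsCyclicallyPresentedTorsion R X)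
    (hR : IsNearlySimpleUniserialDomain R) : Nontrivial X := by
  obtain ⟨a, ha, ha0, ⟨e⟩⟩ := hX
  have := hR.isDomain
  suffices h : principalRightIdeal a ≠ ⊤ by
    have := Submodule.Quotient.nontrivial_iff.2 h
    exact e.toEquiv.nontrivial
  intro h
  have h1 : (1 : R) ∈ principalRightIdeal a := h ▸ Submodule.mem_top
  obtain ⟨b, hb⟩ := Submodule.mem_span_singleton.1 h1
  have hab : a * b.unop = 1 := hb
  have hba : b.unop * a = 1 := by
    apply mul_left_cancel₀ ha0
    rw [← mul_assoc, hab, one_mul, mul_one]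
  have h2 : (1 : R) ∈ Ring.jacobson R := hba ▸ Ideal.mul_mem_left _ _ ha
  exact (((hR.twoSided_iff _ inferInstance).2 rfl).2) ((Ideal.eq_top_iff_one _).2 h2)

theorem IsCyclicallyPresentedTorsion.isUniserial (hX : IsCyclicallyPresentedTorsion R X)
    (hR : IsNearlySimpleUniserialDomain R) : IsUniserial Rᵐᵒᵖ X := by
  obtain ⟨a, -, -, ⟨e⟩⟩ := hX
  intro N P
  set π : R →ₗ[Rᵐᵒᵖ] X := e.symm.toLinearMap ∘ₗ (principalRightIdeal a).mkQ
  have hπ : Function.Surjective π := e.symm.surjective.comp (Submodule.mkQ_surjective _)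
  rcases hR.uniserial_right (N.comap π) (P.comap π) with h | h
  · exact Or.inl ((Submodule.comap_le_comap_iff_of_surjective hπ).1 h)
  · exact Or.inr ((Submodule.comap_le_comap_iff_of_surjective hπ).1 h)

/-- The ideal `I` of `S = End_R X` of morphisms that are not monomorphisms. -/
def idealI (hR : IsNearlySimpleUniserialDomain R) (hX : IsCyclicallyPresentedTorsion R X) :
    Ideal (Module.End Rᵐᵒᵖ X) where
  carrier := {s | ¬ Function.Injective s}
  zero_mem' := by
    have := hX.nontrivial hR
    intro h
    obtain ⟨x, hx⟩ := exists_ne (0 : X)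
    exact hx (h (by simp))
  add_mem' := by
    intro s t hs ht h
    have hs' : LinearMap.ker s ≠ ⊥ := fun e => hs (LinearMap.ker_eq_bot.1 e)
    have ht' : LinearMap.ker t ≠ ⊥ := fun e => ht (LinearMap.ker_eq_bot.1 e)
    obtain ⟨x, hx, hx0⟩ := (Submodule.ne_bot_iff _).1 hs'
    obtain ⟨y, hy, hy0⟩ := (Submodule.ne_bot_iff _).1 ht'
    rcases hX.isUniserial hR (LinearMap.ker s) (LinearMap.ker t) with h' | h'
    · have h1 : t x = 0 := h' hx
      have h2 : s x = 0 := hx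
      exact hx0 (h (by simp [h1, h2]))
    · have h1 : s y = 0 := h' hy
      have h2 : t y = 0 := hy
      exact hy0 (h (by simp [h1, h2]))
  smul_mem' := by
    intro r s hs h
    exact hs (Function.Injective.of_comp (f := r) h)

/-- The ideal `K` of `S = End_R X` of morphisms that are not epimorphisms. -/
def idealK (hR : IsNearlySimpleUniserialDomain R) (hX : IsCyclicallyPresentedTorsion R X) :
    Ideal (Module.End Rᵐᵒᵖ X) where
  carrier := {s | ¬ Function.Surjective s}
  zero_mem' := by
    have := hX.nontrivial hR
    intro h
    obtain ⟨x, hx⟩ := exists_ne (0 : X)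
    obtain ⟨y, hy⟩ := h x
    exact hx (by simpa using hy.symm)
  add_mem' := by
    intro s t hs ht h
    rcases hX.isUniserial hR (LinearMap.range s) (LinearMap.range t) with h' | h'
    · refine ht fun x => ?_
      obtain ⟨y, rfl⟩ := h x
      exact (LinearMap.range t).add_mem (h' ⟨y, rfl⟩) ⟨y, rfl⟩
    · refine hs fun x => ?_
      obtain ⟨y, rfl⟩ := h x
      exact (LinearMap.range s).add_mem ⟨y, rfl⟩ (h' ⟨y, rfl⟩)
  smul_mem' := by
    have := hX.nontrivial hR
    intro r s hs h
    have key : ∀ x, ∃ y, r (s y) = x := h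
    rcases hX.isUniserial hR (LinearMap.range s) (LinearMap.ker r) with h' | h'
    · obtain ⟨x, hx⟩ := exists_ne (0 : X)
      obtain ⟨y, hy⟩ := key x
      exact hx (hy ▸ (h' ⟨y, rfl⟩ : r (s y) = 0))
    · refine hs fun x => ?_
      obtain ⟨y, hy⟩ := key (r x)
      have h1 : x - s y ∈ LinearMap.ker r := by simp [hy]
      have h2 := (LinearMap.range s).add_mem (h' h1) ⟨y, rfl⟩
      simpa using h2

/-- The ideal `J = I ∩ K`. -/
def idealJ (hR : IsNearlySimpleUniserialDomain R) (hX : IsCyclicallyPresentedTorsion R X) :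
    Ideal (Module.End Rᵐᵒᵖ X) :=
  idealI hR hX ⊓ idealK hR hX

/-- `0 → X → X → X → 0` with maps `f` and `g` is a short exact sequence. -/
def IsShortExact (f g : Module.End Rᵐᵒᵖ X) : Prop :=
  Function.Injective f ∧ Function.Exact f g ∧ Function.Surjective g

/-- `Iω` is a countably generated pure submodule of `I` that contains `S g`, such that
`Iω f = Jω` and `Jω f = Jω`, where `Jω = Iω ∩ J`. -/
structure IsOmega (hR : IsNearlySimpleUniserialDomain R) (hX : IsCyclicallyPresentedTorsion R X)
    (f g : Module.End Rᵐᵒᵖ X) (Iω : Ideal (Module.End Rᵐᵒᵖ X)) : Prop where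
  le_I : Iω ≤ idealI hR hX
  countablyGenerated : ∃ s : Set (Module.End Rᵐᵒᵖ X), s.Countable ∧ Ideal.span s = Iω
  pure : IsPure (Iω.submoduleOf (idealI hR hX))
  mem : Ideal.span {g} ≤ Iω
  map_I : Submodule.map (rightMul f) Iω = Iω ⊓ idealJ hR hX
  map_J : Submodule.map (rightMul f) (Iω ⊓ idealJ hR hX) = Iω ⊓ idealJ hR hX

theorem IsOmega.g_mem {hR : IsNearlySimpleUniserialDomain R}
    {hX : IsCyclicallyPresentedTorsion R X} {f g : Module.End Rᵐᵒᵖ X}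
    {Iω : Ideal (Module.End Rᵐᵒᵖ X)} (h : IsOmega hR hX f g Iω) : g ∈ Iω :=
  h.mem (Ideal.subset_span rfl)

/-- The left `S`-module `Iω / I g`. -/
abbrev IomegaModIg (hR : IsNearlySimpleUniserialDomain R) (hX : IsCyclicallyPresentedTorsion R X)
    (g : Module.End Rᵐᵒᵖ X) (Iω : Ideal (Module.End Rᵐᵒᵖ X)) : Type v :=
  Iω ⧸ (Submodule.map (rightMul g) (idealI hR hX)).submoduleOf Iω

/-- The morphism `sω : S / I → Iω / I g`, `x + I ↦ x g + I g`. -/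
abbrev sOmega {hR : IsNearlySimpleUniserialDomain R} {hX : IsCyclicallyPresentedTorsion R X}
    {f g : Module.End Rᵐᵒᵖ X} {Iω : Ideal (Module.End Rᵐᵒᵖ X)} (h : IsOmega hR hX f g Iω) :
    (Module.End Rᵐᵒᵖ X ⧸ idealI hR hX) →ₗ[Module.End Rᵐᵒᵖ X] IomegaModIg hR hX g Iω :=
  pushoutMap (idealI hR hX) Iω g h.g_mem

end Ideals

end DubrovinPuninski

/-! Endomorphisms of `X = R/aR` are left multiplications by elements r with r a = a r'; such a map
is epi iff r is a unit and mono iff r' is a unit. Near simplicity makes any two nonzero elements a,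
c of the radical associated, p c = a q with p, q units (`exists_associated`), so R/cR ≅ R/aR. Hence
nonzero images, kernels of proper epis and cokernels of proper monos are copies of `X`. Moreover a
proper mono plus a proper epi lies outside both `I` and `K`, so it is a unit; most arguments below
turn on this trick. `IsDPPair` records the resulting arithmetic of `S`, and the module theory uses
nothing else. Elements outside `I` and `K` are called monos and epis.

Purity of Iω in `I` moves solutions of b y = c from `I` into Iω. Since `S` is left Bézout
(`exists_generator`), absolute purity of Iω/Ig reduces, by induction on the rank of a free module,
to divisibility conditions for single elements. Flatness holds because every relation d p = 0 in
Iω/Ig is explained by p = b p' with d b = 0. Uniseriality is `comparable_mod`.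

If q : S/I → N does not split, then q(1) lies in IN = gN, because N/IN is semisimple. Iω is the
union of a countable chain of free left ideals S t_k with t_0 = g, t_k = x_k t_{k+1} and x_k epi.
Each x_k maps gN onto a set containing gN, so elements n_k of gN with n_0 = q(1) and n_k = x_k
n_{k+1} can be chosen one after another; t_k ↦ n_k defines a map on Iω that factors q through sω.
The map sω does not split, since sω(1) is divisible by g while g kills S/I.

The target of a minimal left almost split map would be cyclic and isomorphic to Iω/Ig, which is not
cyclic. An almost split sequence would begin with such a minimal map. -/

namespace DubrovinPuninski

/-! ### Nearly simple uniserial domains: association of radical elements -/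

section NearlySimple

variable {R : Type u} [Ring R]

namespace IsNearlySimpleUniserialDomain

theorem comparable_left (hR : IsNearlySimpleUniserialDomain R) (p q : R) :
    (∃ w, p = w * q) ∨ ∃ w, q = w * p := by
  rcases hR.uniserial_left (Ideal.span {p}) (Ideal.span {q}) with h | h
  · obtain ⟨w, hw⟩ := Ideal.mem_span_singleton'.1 (h (Ideal.subset_span rfl))
    exact Or.inl ⟨w, hw.symm⟩
  · obtain ⟨w, hw⟩ := Ideal.mem_span_singleton'.1 (h (Ideal.subset_span rfl))
    exact Or.inr ⟨w, hw.symm⟩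

theorem comparable_right (hR : IsNearlySimpleUniserialDomain R) (p q : R) :
    (∃ w, p = q * w) ∨ ∃ w, q = p * w := by
  rcases hR.uniserial_right (Submodule.span Rᵐᵒᵖ {p}) (Submodule.span Rᵐᵒᵖ {q}) with h | h
  · obtain ⟨w, hw⟩ := Submodule.mem_span_singleton.1 (h (Submodule.subset_span rfl))
    exact Or.inl ⟨w.unop, hw.symm⟩
  · obtain ⟨w, hw⟩ := Submodule.mem_span_singleton.1 (h (Submodule.subset_span rfl))
    exact Or.inr ⟨w.unop, hw.symm⟩

theorem jacobson_ne_top (hR : IsNearlySimpleUniserialDomain R) : Ring.jacobson R ≠ ⊤ :=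
  ((hR.twoSided_iff _ inferInstance).2 rfl).2

theorem isUnit_of_mul_eq_one (hR : IsNearlySimpleUniserialDomain R) {x y : R} (h : x * y = 1) :
    IsUnit x := by
  have := hR.isDomain
  have hx : x ≠ 0 := by
    rintro rfl
    simp at h
  refine ⟨⟨x, y, h, mul_left_cancel₀ hx ?_⟩, rfl⟩
  rw [← mul_assoc, h, one_mul, mul_one]

/-- The left ideals form a chain, so `R` is local; in a domain one-sided inverses are two-sided. -/
theorem mem_jacobson_iff (hR : IsNearlySimpleUniserialDomain R) {r : R} :
    r ∈ Ring.jacobson R ↔ ¬ IsUnit r := by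
  have := hR.isDomain
  refine ⟨fun h hu => hR.jacobson_ne_top (Ideal.eq_top_of_isUnit_mem _ h hu), fun h => ?_⟩
  refine Submodule.mem_sInf.2 fun m hm => ?_
  by_contra hr
  rcases hR.uniserial_left (Ideal.span {r}) m with h' | h'
  · exact hr (h' (Ideal.subset_span rfl))
  · have htop : Ideal.span {r} = ⊤ := by
      refine hm.2 _ (lt_of_le_of_ne h' ?_)
      rintro rfl
      exact hr (Ideal.subset_span rfl)
    obtain ⟨w, hw⟩ := Ideal.mem_span_singleton'.1 ((Ideal.eq_top_iff_one _).1 htop)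
    obtain ⟨u, rfl⟩ := hR.isUnit_of_mul_eq_one hw
    exact h ((Units.isUnit_units_mul u r).1 (hw ▸ isUnit_one))

theorem isUnit_add_of_mem (hR : IsNearlySimpleUniserialDomain R) {x y : R}
    (hx : x ∈ Ring.jacobson R) (hy : IsUnit y) : IsUnit (x + y) := by
  by_contra h
  refine hR.mem_jacobson_iff.1 ?_ hy
  have := (Ring.jacobson R).sub_mem (hR.mem_jacobson_iff.2 h) hx
  simpa using this

theorem comparable_left' (hR : IsNearlySimpleUniserialDomain R) (p q : R) :
    (∃ w ∈ Ring.jacobson R, p = w * q) ∨ ∃ w, q = w * p := by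
  rcases hR.comparable_left p q with ⟨w, hw⟩ | h
  · by_cases hu : IsUnit w
    · obtain ⟨w, rfl⟩ := hu
      exact Or.inr ⟨↑w⁻¹, by simp [hw]⟩
    · exact Or.inl ⟨w, hR.mem_jacobson_iff.2 hu, hw⟩
  · exact Or.inr h

theorem comparable_right' (hR : IsNearlySimpleUniserialDomain R) (p q : R) :
    (∃ w ∈ Ring.jacobson R, p = q * w) ∨ ∃ w, q = p * w := by
  rcases hR.comparable_right p q with ⟨w, hw⟩ | h
  · by_cases hu : IsUnit w
    · obtain ⟨w, rfl⟩ := hu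
      exact Or.inr ⟨↑w⁻¹, by simp [hw]⟩
    · exact Or.inl ⟨w, hR.mem_jacobson_iff.2 hu, hw⟩
  · exact Or.inr h

/-- The nonzero two-sided ideal `J a J` is the whole radical, and sums are not needed. -/
theorem exists_eq_mul_mul (hR : IsNearlySimpleUniserialDomain R) {a b : R}
    (ha : a ∈ Ring.jacobson R) (ha0 : a ≠ 0) (hb : b ∈ Ring.jacobson R) :
    ∃ x ∈ Ring.jacobson R, ∃ y ∈ Ring.jacobson R, b = x * a * y := by
  have := hR.isDomain
  let A : Ideal R :=
    { carrier := {b | ∃ x ∈ Ring.jacobson R, ∃ y ∈ Ring.jacobson R, b = x * a * y}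
      zero_mem' := ⟨0, zero_mem _, 0, zero_mem _, by simp⟩
      add_mem' := by
        rintro _ _ ⟨x, hx, y, hy, rfl⟩ ⟨x', hx', y', hy', rfl⟩
        rcases hR.comparable_left (a * y) (a * y') with ⟨w, hw⟩ | ⟨w, hw⟩
        · refine ⟨x * w + x', add_mem (Ideal.mul_mem_right _ _ hx) hx', y', hy', ?_⟩
          simp only [mul_assoc, add_mul, hw]
        · refine ⟨x + x' * w, add_mem hx (Ideal.mul_mem_right _ _ hx'), y, hy, ?_⟩
          simp only [mul_assoc, add_mul, hw]
      smul_mem' := by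
        rintro r _ ⟨x, hx, y, hy, rfl⟩
        exact ⟨r * x, Ideal.mul_mem_left _ _ hx, y, hy, by simp [mul_assoc]⟩ }
  have hA : A.IsTwoSided := ⟨by
    rintro _ r ⟨x, hx, y, hy, rfl⟩
    exact ⟨x, hx, y * r, Ideal.mul_mem_right _ _ hy, by simp [mul_assoc]⟩⟩
  have hA' : A = Ring.jacobson R := by
    refine (hR.twoSided_iff A hA).1 ⟨?_, ?_⟩
    · refine (Submodule.ne_bot_iff _).2 ⟨a * a * a, ⟨a, ha, a, ha, rfl⟩, ?_⟩
      simp [ha0]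
    · intro h
      obtain ⟨x, hx, y, hy, h1⟩ := (Ideal.eq_top_iff_one A).1 h
      refine hR.jacobson_ne_top ((Ideal.eq_top_iff_one _).2 ?_)
      rw [h1]
      exact Ideal.mul_mem_left _ _ hy
  have hbA : b ∈ A := by
    rw [hA']
    exact hb
  exact hbA

/-- Write a = x c y with x, y in the radical. If a were in neither J c nor J c (1 + y), both c and c
(1 + y) would be left multiples of a, hence so would c y; then a = x c y would make x invertible. -/
theorem exists_eq_mul_unit (hR : IsNearlySimpleUniserialDomain R) {a c : R}
    (ha : a ∈ Ring.jacobson R) (ha0 : a ≠ 0) (hc : c ∈ Ring.jacobson R) (hc0 : c ≠ 0) :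
    ∃ x ∈ Ring.jacobson R, ∃ u : Rˣ, a = x * c * u := by
  have := hR.isDomain
  obtain ⟨x, hx, y, hy, h⟩ := hR.exists_eq_mul_mul hc hc0 ha
  rcases hR.comparable_left' a c with ⟨w, hw, h1⟩ | ⟨w, h1⟩
  · exact ⟨w, hw, 1, by simpa using h1⟩
  obtain ⟨u, hu⟩ := hR.isUnit_add_of_mem hy isUnit_one
  rcases hR.comparable_left' a (c * u) with ⟨w', hw, h2⟩ | ⟨w', h2⟩
  · exact ⟨w', hw, u, by rw [h2, mul_assoc]⟩
  exfalso
  have h3 : c * y = (w' - w) * a := by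
    rw [sub_mul, ← h2, ← h1, hu]
    noncomm_ring
  have h4 : x * (w' - w) = 1 := by
    apply mul_right_cancel₀ ha0
    rw [mul_assoc, ← h3, ← mul_assoc, ← h, one_mul]
  exact hR.mem_jacobson_iff.1 hx (hR.isUnit_of_mul_eq_one h4)

theorem exists_eq_unit_mul (hR : IsNearlySimpleUniserialDomain R) {a c : R}
    (ha : a ∈ Ring.jacobson R) (ha0 : a ≠ 0) (hc : c ∈ Ring.jacobson R) (hc0 : c ≠ 0) :
    ∃ y ∈ Ring.jacobson R, ∃ u : Rˣ, a = u * c * y := by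
  have := hR.isDomain
  obtain ⟨x, hx, y, hy, h⟩ := hR.exists_eq_mul_mul hc hc0 ha
  rcases hR.comparable_right' a c with ⟨w, hw, h1⟩ | ⟨w, h1⟩
  · exact ⟨w, hw, 1, by simpa using h1⟩
  obtain ⟨u, hu⟩ := hR.isUnit_add_of_mem hx isUnit_one
  rcases hR.comparable_right' a (u * c) with ⟨w', hw, h2⟩ | ⟨w', h2⟩
  · exact ⟨w', hw, u, by rw [h2]⟩
  exfalso
  have h3 : x * c = a * (w' - w) := by
    rw [mul_sub, ← h2, ← h1, hu]
    noncomm_ring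
  have h4 : (w' - w) * y = 1 := by
    apply mul_left_cancel₀ ha0
    rw [← mul_assoc, ← h3, ← h, mul_one]
  exact hR.jacobson_ne_top ((Ideal.eq_top_iff_one _).2 (h4 ▸ Ideal.mul_mem_left _ _ hy))

/-- Any two nonzero elements of the radical are associated. -/
theorem exists_associated (hR : IsNearlySimpleUniserialDomain R) {a c : R}
    (ha : a ∈ Ring.jacobson R) (ha0 : a ≠ 0) (hc : c ∈ Ring.jacobson R) (hc0 : c ≠ 0) :
    ∃ p q : Rˣ, p * c = a * q := by
  obtain ⟨x, hx, u, h1⟩ := hR.exists_eq_mul_unit ha ha0 hc hc0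
  obtain ⟨y, hy, w, h2⟩ := hR.exists_eq_unit_mul hc hc0 ha ha0
  -- The relations x c = a u⁻¹ and w⁻¹ c = a y are added; each coefficient becomes a unit plus a
  -- radical element.
  obtain ⟨p, hp⟩ := hR.isUnit_add_of_mem hx (w⁻¹).isUnit
  obtain ⟨q, hq⟩ := hR.isUnit_add_of_mem hy (u⁻¹).isUnit
  refine ⟨p, q, ?_⟩
  have h1' : x * c = a * ↑u⁻¹ := by simp [h1]
  have h2' : ↑w⁻¹ * c = a * y := by simp [h2, mul_assoc]
  rw [hp, hq, add_mul, mul_add, h1', h2', add_comm]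

end IsNearlySimpleUniserialDomain

end NearlySimple

/-! ### Axioms for the endomorphism ring -/

section Pairs

variable {S : Type u} [Ring S]

/-- `f` and `g` are weak kernel and weak cokernel of each other. -/
structure ExactPair (f g : S) : Prop where
  mul_eq_zero : g * f = 0
  eq_mul_of_mul_eq_zero : ∀ t, t * f = 0 → ∃ y, t = y * g
  eq_mul_of_mul_eq_zero' : ∀ t, g * t = 0 → ∃ y, t = f * y

/-- The arithmetic of the endomorphism ring `S` of `R / a R`, in terms of the ideal `I` of
non-monomorphisms and the ideal `K` of non-epimorphisms. -/
structure IsDPPair (I K : Ideal S) : Prop where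
  one_notMem_I : (1 : S) ∉ I
  one_notMem_K : (1 : S) ∉ K
  mul_mem_I : ∀ s ∈ I, ∀ t, s * t ∈ I
  mul_mem_K : ∀ s ∈ K, ∀ t, s * t ∈ K
  prime_I : ∀ s t, s ∉ I → t ∉ I → s * t ∉ I
  prime_K : ∀ s t, s ∉ K → t ∉ K → s * t ∉ K
  isUnit : ∀ s, s ∉ I → s ∉ K → IsUnit s
  factor : ∀ s, s ≠ 0 → ∃ f g, f ∉ I ∧ g ∉ K ∧ s = f * g
  cancel_I : ∀ f t, f ∉ I → f * t = 0 → t = 0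
  cancel_K : ∀ g t, g ∉ K → t * g = 0 → t = 0
  eq_mul_of_mem_K : ∀ f ∉ I, ∀ s ∈ K, ∃ y, s = y * f
  eq_mul_of_mem_I : ∀ g ∉ K, ∀ s ∈ I, ∃ y, s = g * y
  exists_left : ∀ g ∈ I, g ∉ K → ∃ f ∈ K, f ∉ I ∧ ExactPair f g
  exists_right : ∀ f ∈ K, f ∉ I → ∃ g ∈ I, g ∉ K ∧ ExactPair f g
  comparable : ∀ g h, g ∉ K → h ∉ K → (∃ y, g = y * h) ∨ ∃ y, h = y * g
  exists_mono : ∃ f ∈ K, f ∉ I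

end Pairs

/-! ### Endomorphisms of R/aR as ring elements -/

section Presented

variable {R : Type u} [Ring R] {X : Type v} [AddCommGroup X] [Module Rᵐᵒᵖ X]

/-- `X` is generated by `ε` with annihilator `a R`. -/
structure IsPresentedBy (ε : X) (a : R) : Prop where
  exists_smul : ∀ x : X, ∃ r : R, op r • ε = x
  smul_eq_zero : ∀ r : R, op r • ε = 0 ↔ ∃ t, r = a * t

theorem IsCyclicallyPresentedTorsion.exists_isPresentedBy
    (hX : IsCyclicallyPresentedTorsion R X) :
    ∃ (ε : X) (a : R), a ∈ Ring.jacobson R ∧ a ≠ 0 ∧ IsPresentedBy ε a := by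
  obtain ⟨a, ha, ha0, ⟨e⟩⟩ := hX
  have key : ∀ r : R, op r • e.symm ((principalRightIdeal a).mkQ 1) =
      e.symm ((principalRightIdeal a).mkQ r) := by
    intro r
    rw [← map_smul, ← map_smul]
    simp
  refine ⟨e.symm ((principalRightIdeal a).mkQ 1), a, ha, ha0, fun x => ?_, fun r => ?_⟩
  · obtain ⟨r, hr⟩ := Submodule.mkQ_surjective _ (e x)
    exact ⟨r, by rw [key, hr, e.symm_apply_apply]⟩
  · rw [key, LinearEquiv.map_eq_zero_iff, Submodule.mkQ_apply, Submodule.Quotient.mk_eq_zero,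
      principalRightIdeal, Submodule.mem_span_singleton]
    constructor
    · rintro ⟨t, ht⟩
      exact ⟨t.unop, ht.symm⟩
    · rintro ⟨t, ht⟩
      exact ⟨op t, ht.symm⟩

/-- The endomorphism `s` is induced by `r`, and `r a = a r'`. -/
structure Rep (ε : X) (a : R) (s : Module.End Rᵐᵒᵖ X) (r r' : R) : Prop where
  apply_gen : s ε = op r • ε
  comm : r * a = a * r'

namespace IsPresentedBy

variable {ε : X} {a : R}

theorem hom_ext (hε : IsPresentedBy ε a) {s t : Module.End Rᵐᵒᵖ X} (h : s ε = t ε) : s = t := by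
  ext x
  obtain ⟨r, rfl⟩ := hε.exists_smul x
  rw [map_smul, map_smul, h]

theorem exists_rep (hε : IsPresentedBy ε a) (s : Module.End Rᵐᵒᵖ X) : ∃ r r', Rep ε a s r r' := by
  obtain ⟨r, hr⟩ := hε.exists_smul (s ε)
  have h : op (r * a) • ε = 0 := by
    rw [MulOpposite.op_mul, mul_smul, hr, ← map_smul, (hε.smul_eq_zero a).2 ⟨1, by simp⟩, map_zero]
  obtain ⟨r', hr'⟩ := (hε.smul_eq_zero _).1 h
  exact ⟨r, r', hr.symm, hr'⟩

theorem exists_end (hε : IsPresentedBy ε a) {r r' : R} (h : r * a = a * r') :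
    ∃ s : Module.End Rᵐᵒᵖ X, Rep ε a s r r' := by
  let φ : Rᵐᵒᵖ →ₗ[Rᵐᵒᵖ] X := LinearMap.toSpanSingleton Rᵐᵒᵖ X ε
  let ψ : Rᵐᵒᵖ →ₗ[Rᵐᵒᵖ] X := LinearMap.toSpanSingleton Rᵐᵒᵖ X (op r • ε)
  have hφ : Function.Surjective φ := fun x => by
    obtain ⟨r, hr⟩ := hε.exists_smul x
    exact ⟨op r, hr⟩
  have hker : LinearMap.ker φ ≤ LinearMap.ker ψ := by
    intro q hq
    obtain ⟨t, ht⟩ := (hε.smul_eq_zero q.unop).1 hq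
    change q • op r • ε = 0
    rw [smul_smul, ← MulOpposite.op_unop q, ← MulOpposite.op_mul, ht, ← mul_assoc, h, mul_assoc]
    exact (hε.smul_eq_zero _).2 ⟨_, rfl⟩
  let s : X →ₗ[Rᵐᵒᵖ] X := (LinearMap.ker φ).liftQ ψ hker ∘ₗ
    (φ.quotKerEquivOfSurjective hφ).symm.toLinearMap
  refine ⟨s, ?_, h⟩
  have h1 : (φ.quotKerEquivOfSurjective hφ).symm ε = (LinearMap.ker φ).mkQ 1 := by
    rw [LinearEquiv.symm_apply_eq]
    change ε = (1 : Rᵐᵒᵖ) • ε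
    rw [one_smul]
  change (LinearMap.ker φ).liftQ ψ hker ((φ.quotKerEquivOfSurjective hφ).symm ε) = _
  rw [h1, Submodule.mkQ_apply, Submodule.liftQ_apply]
  exact one_smul _ _

end IsPresentedBy

theorem Rep.mul {ε : X} {a : R} {s t : Module.End Rᵐᵒᵖ X} {r r' q q' : R}
    (hs : Rep ε a s r r') (ht : Rep ε a t q q') : Rep ε a (s * t) (r * q) (r' * q') := by
  refine ⟨?_, ?_⟩
  · rw [Module.End.mul_apply, ht.apply_gen, map_smul, hs.apply_gen, smul_smul, MulOpposite.op_mul]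
  · rw [mul_assoc, ht.comm, ← mul_assoc, hs.comm, mul_assoc]

theorem Rep.apply {ε : X} {a : R} {s : Module.End Rᵐᵒᵖ X} {r r' : R}
    (hs : Rep ε a s r r') (q : R) : s (op q • ε) = op (r * q) • ε := by
  rw [map_smul, hs.apply_gen, smul_smul, MulOpposite.op_mul]

namespace Rep

variable {ε : X} {a : R} {s : Module.End Rᵐᵒᵖ X} {r r' : R}

theorem surjective_iff (hR : IsNearlySimpleUniserialDomain R) (ha : a ∈ Ring.jacobson R)
    (hε : IsPresentedBy ε a) (hs : Rep ε a s r r') : Function.Surjective s ↔ IsUnit r := by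
  constructor
  · intro h
    obtain ⟨x, hx⟩ := h ε
    obtain ⟨q, rfl⟩ := hε.exists_smul x
    rw [hs.apply] at hx
    have h0 : op (r * q - 1) • ε = 0 := by
      rw [MulOpposite.op_sub, sub_smul, hx, MulOpposite.op_one, one_smul, sub_self]
    obtain ⟨t, ht⟩ := (hε.smul_eq_zero _).1 h0
    by_contra hr
    have h1 : r * q - a * t ∈ Ring.jacobson R :=
      sub_mem (Ideal.mul_mem_right _ _ (hR.mem_jacobson_iff.2 hr)) (Ideal.mul_mem_right _ _ ha)
    rw [← ht, sub_sub_cancel] at h1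
    exact hR.mem_jacobson_iff.1 h1 isUnit_one
  · rintro ⟨p, rfl⟩ x
    obtain ⟨q, rfl⟩ := hε.exists_smul x
    exact ⟨op (↑p⁻¹ * q) • ε, by rw [hs.apply, Units.mul_inv_cancel_left]⟩

theorem exists_eq_mul (hR : IsNearlySimpleUniserialDomain R)
    (hε : IsPresentedBy ε a) (hs : Rep ε a s r r') (hs0 : s ≠ 0) :
    ∃ c, a = r * c := by
  rcases hR.comparable_right a r with h | ⟨t, ht⟩
  · exact h
  · refine absurd (hε.hom_ext ?_) hs0
    rw [hs.apply_gen, (hε.smul_eq_zero _).2 ⟨t, ht⟩]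
    rfl

/-- For s ≠ 0 one has a = r c, so the kernel of s is cR/aR. Cancelling r in r c r' = a r' = r a
gives c r' = a, and the kernel vanishes exactly when r' is a unit. -/
theorem injective_iff (hR : IsNearlySimpleUniserialDomain R) (ha : a ∈ Ring.jacobson R)
    (ha0 : a ≠ 0) (hε : IsPresentedBy ε a) (hs : Rep ε a s r r') :
    Function.Injective s ↔ IsUnit r' := by
  have := hR.isDomain
  have hε0 : ε ≠ 0 := by
    intro h
    obtain ⟨t, ht⟩ := (hε.smul_eq_zero 1).1 (by simp [h])
    exact hR.jacobson_ne_top ((Ideal.eq_top_iff_one _).2 (ht ▸ Ideal.mul_mem_right _ _ ha))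
  constructor
  · intro h
    have hs0 : s ≠ 0 := by
      rintro rfl
      exact hε0 (h (by simp))
    obtain ⟨c, hc⟩ := hs.exists_eq_mul hR hε hs0
    have h1 : op c • ε = 0 := by
      apply h
      rw [hs.apply, ← hc, map_zero]
      exact (hε.smul_eq_zero _).2 ⟨1, by simp⟩
    obtain ⟨w, hw⟩ := (hε.smul_eq_zero _).1 h1
    refine hR.isUnit_of_mul_eq_one (y := w) (mul_left_cancel₀ ha0 ?_)
    rw [← mul_assoc, ← hs.comm, mul_assoc, ← hw, ← hc, mul_one]
  · rintro ⟨p, rfl⟩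
    refine (injective_iff_map_eq_zero s).2 fun x hx => ?_
    obtain ⟨q, rfl⟩ := hε.exists_smul x
    rw [hs.apply] at hx
    obtain ⟨t, ht⟩ := (hε.smul_eq_zero _).1 hx
    have hs0 : s ≠ 0 := by
      rintro rfl
      obtain ⟨t, ht⟩ := (hε.smul_eq_zero r).1 (by rw [← hs.apply_gen]; rfl)
      have h2 := hs.comm
      rw [ht, mul_assoc] at h2
      exact hR.mem_jacobson_iff.1 (mul_left_cancel₀ ha0 h2 ▸ Ideal.mul_mem_left _ _ ha) p.isUnit
    obtain ⟨c, hc⟩ := hs.exists_eq_mul hR hε hs0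
    have hr0 : r ≠ 0 := by
      rintro rfl
      exact ha0 (by simpa using hc)
    have h3 : a = c * p := by
      apply mul_left_cancel₀ hr0
      rw [hs.comm, ← mul_assoc, ← hc]
    have h4 : c = a * ↑p⁻¹ := by simp [h3]
    have h5 : q = c * t := by
      apply mul_left_cancel₀ hr0
      rw [ht, ← mul_assoc, ← hc]
    exact (hε.smul_eq_zero _).2 ⟨↑p⁻¹ * t, by rw [h5, h4, mul_assoc]⟩

end Rep

/-! ### Factorizations of endomorphisms -/

theorem exists_eq_mul_of_range_le {f t : Module.End Rᵐᵒᵖ X} (hf : Function.Injective f)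
    (h : LinearMap.range t ≤ LinearMap.range f) : ∃ y, t = f * y := by
  refine ⟨(LinearEquiv.ofInjective f hf).symm.toLinearMap ∘ₗ
    t.codRestrict (LinearMap.range f) (fun x => h ⟨x, rfl⟩), ?_⟩
  ext x
  have := LinearEquiv.ofInjective_symm_apply (f := f) (h := hf) ⟨t x, h ⟨x, rfl⟩⟩
  exact this.symm

theorem exists_eq_mul_of_ker_le {g t : Module.End Rᵐᵒᵖ X} (hg : Function.Surjective g)
    (h : LinearMap.ker g ≤ LinearMap.ker t) : ∃ y, t = y * g := by
  refine ⟨(LinearMap.ker g).liftQ t h ∘ₗ (g.quotKerEquivOfSurjective hg).symm.toLinearMap, ?_⟩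
  ext x
  have h1 : (g.quotKerEquivOfSurjective hg).symm (g x) = (LinearMap.ker g).mkQ x := by
    rw [LinearEquiv.symm_apply_eq]
    rfl
  change t x = (LinearMap.ker g).liftQ t h ((g.quotKerEquivOfSurjective hg).symm (g x))
  rw [h1]
  rfl

theorem IsShortExact.exactPair {f g : Module.End Rᵐᵒᵖ X} (h : IsShortExact f g) :
    ExactPair f g := by
  obtain ⟨hf, he, hg⟩ := h
  refine ⟨?_, fun t ht => ?_, fun t ht => ?_⟩
  · ext x
    exact (he _).2 ⟨x, rfl⟩
  · refine exists_eq_mul_of_ker_le hg fun x hx => ?_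
    obtain ⟨y, rfl⟩ := (he x).1 hx
    exact LinearMap.congr_fun ht y
  · refine exists_eq_mul_of_range_le hf ?_
    rintro _ ⟨x, rfl⟩
    exact (he _).1 (LinearMap.congr_fun ht x)

end Presented

/-! ### The endomorphism ring of R/aR satisfies the axioms -/

section Endomorphisms

variable {R : Type u} [Ring R] {X : Type v} [AddCommGroup X] [Module Rᵐᵒᵖ X]
  {ε : X} {a : R}

namespace IsPresentedBy

theorem ext_rep (hε : IsPresentedBy ε a) {s t : Module.End Rᵐᵒᵖ X} {r r' q q' : R}
    (hs : Rep ε a s r r') (ht : Rep ε a t q q') (h : r = q) : s = t :=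
  hε.hom_ext (by rw [hs.apply_gen, ht.apply_gen, h])

/-- With a = r c, the image rR/aR is isomorphic to R/cR, and p c = a q turns this into R/aR through
left multiplication by p. -/
theorem exists_factor (hR : IsNearlySimpleUniserialDomain R) (ha : a ∈ Ring.jacobson R)
    (ha0 : a ≠ 0) (hε : IsPresentedBy ε a) {s : Module.End Rᵐᵒᵖ X} (hs0 : s ≠ 0) :
    ∃ f g : Module.End Rᵐᵒᵖ X, Function.Injective f ∧ Function.Surjective g ∧ s = f * g := by
  have := hR.isDomain
  obtain ⟨r, r', hs⟩ := hε.exists_rep s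
  obtain ⟨c, hc⟩ := hs.exists_eq_mul hR hε hs0
  have hr0 : r ≠ 0 := by
    rintro rfl
    exact ha0 (by simpa using hc)
  have hc0 : c ≠ 0 := by
    rintro rfl
    exact ha0 (by simpa using hc)
  have hcr : c * r' = a := by
    apply mul_left_cancel₀ hr0
    rw [← mul_assoc, ← hc, hs.comm]
  have hcJ : c ∈ Ring.jacobson R := by
    refine hR.mem_jacobson_iff.2 ?_
    rintro ⟨c, rfl⟩
    refine hs0 (hε.hom_ext ?_)
    rw [hs.apply_gen, (hε.smul_eq_zero _).2 ⟨↑c⁻¹, by rw [hc]; simp⟩]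
    rfl
  obtain ⟨p, q, hpq⟩ := hR.exists_associated ha ha0 hcJ hc0
  have hpq' : ↑p⁻¹ * a = c * ↑q⁻¹ := by
    rw [Units.inv_mul_eq_iff_eq_mul, ← mul_assoc, hpq, Units.mul_inv_cancel_right]
  obtain ⟨g, hg⟩ := hε.exists_end (r := p) (r' := q * r') (by rw [← mul_assoc, ← hpq, mul_assoc, hcr])
  obtain ⟨f, hf⟩ := hε.exists_end (r := r * ↑p⁻¹) (r' := ↑q⁻¹)
    (by rw [mul_assoc, hpq', ← mul_assoc, ← hc])
  exact ⟨f, g, (hf.injective_iff hR ha ha0 hε).2 (Units.isUnit _),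
    (hg.surjective_iff hR ha hε).2 (Units.isUnit _), hε.ext_rep hs (hf.mul hg) (by simp)⟩

/-- As r is a unit, the kernel of `g` is r⁻¹aR/aR. Since a = r⁻¹ a r', it is isomorphic to R/r'R,
hence to R/aR. -/
theorem exists_isShortExact_left (hR : IsNearlySimpleUniserialDomain R)
    (ha : a ∈ Ring.jacobson R) (ha0 : a ≠ 0) (hε : IsPresentedBy ε a) {g : Module.End Rᵐᵒᵖ X}
    (hg : Function.Surjective g) (hg' : ¬ Function.Injective g) :
    ∃ f : Module.End Rᵐᵒᵖ X, ¬ Function.Surjective f ∧ IsShortExact f g := by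
  have := hR.isDomain
  obtain ⟨r, r', hgr⟩ := hε.exists_rep g
  have hcomm := hgr.comm
  obtain ⟨r, rfl⟩ := (hgr.surjective_iff hR ha hε).1 hg
  have hr' : r' ∈ Ring.jacobson R :=
    hR.mem_jacobson_iff.2 fun h => hg' ((hgr.injective_iff hR ha ha0 hε).2 h)
  have hr'0 : r' ≠ 0 := by
    rintro rfl
    simp [ha0] at hcomm
  obtain ⟨p, q, hpq⟩ := hR.exists_associated ha ha0 hr' hr'0
  have hpq' : ↑p⁻¹ * a = r' * ↑q⁻¹ := by
    rw [Units.inv_mul_eq_iff_eq_mul, ← mul_assoc, hpq, Units.mul_inv_cancel_right]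
  obtain ⟨f, hf⟩ := hε.exists_end (r := ↑r⁻¹ * a * ↑p⁻¹) (r' := ↑q⁻¹) (by
    rw [mul_assoc, hpq', ← mul_assoc, mul_assoc _ a, ← hcomm, Units.inv_mul_cancel_left])
  refine ⟨f, fun h => ?_, (hf.injective_iff hR ha ha0 hε).2 (Units.isUnit _), fun x => ?_, hg⟩
  · exact hR.mem_jacobson_iff.1 (Ideal.mul_mem_right _ _ (Ideal.mul_mem_left _ _ ha))
      ((hf.surjective_iff hR ha hε).1 h)
  · constructor
    · intro hx
      obtain ⟨k, rfl⟩ := hε.exists_smul x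
      rw [hgr.apply] at hx
      obtain ⟨t, ht⟩ := (hε.smul_eq_zero _).1 hx
      refine ⟨op (p * t) • ε, ?_⟩
      rw [hf.apply, ← mul_assoc, Units.inv_mul_cancel_right, mul_assoc, ← ht,
        Units.inv_mul_cancel_left]
    · rintro ⟨y, rfl⟩
      obtain ⟨k, rfl⟩ := hε.exists_smul y
      rw [hf.apply, hgr.apply]
      exact (hε.smul_eq_zero _).2 ⟨↑p⁻¹ * k, by simp [mul_assoc]⟩

/-- The cokernel of `f` is R/rR with r nonzero in the radical, hence isomorphic to R/aR. -/
theorem exists_isShortExact_right (hR : IsNearlySimpleUniserialDomain R)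
    (ha : a ∈ Ring.jacobson R) (ha0 : a ≠ 0) (hε : IsPresentedBy ε a) {f : Module.End Rᵐᵒᵖ X}
    (hf : Function.Injective f) (hf' : ¬ Function.Surjective f) :
    ∃ g : Module.End Rᵐᵒᵖ X, ¬ Function.Injective g ∧ IsShortExact f g := by
  have := hR.isDomain
  obtain ⟨r, r', hfr⟩ := hε.exists_rep f
  have hcomm := hfr.comm
  obtain ⟨r', rfl⟩ := (hfr.injective_iff hR ha ha0 hε).1 hf
  have hr : r ∈ Ring.jacobson R :=
    hR.mem_jacobson_iff.2 fun h => hf' ((hfr.surjective_iff hR ha hε).2 h)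
  have hr0 : r ≠ 0 := by
    rintro rfl
    simp [ha0] at hcomm
  obtain ⟨p, q, hpq⟩ := hR.exists_associated ha ha0 hr hr0
  obtain ⟨g, hg⟩ := hε.exists_end (r := p) (r' := q * a * ↑r'⁻¹) (by
    rw [← mul_assoc, ← mul_assoc, ← hpq, mul_assoc (p : R), hcomm, ← mul_assoc,
      Units.mul_inv_cancel_right])
  refine ⟨g, fun h => ?_, hf, fun x => ?_, (hg.surjective_iff hR ha hε).2 (Units.isUnit _)⟩
  · exact hR.mem_jacobson_iff.1 (Ideal.mul_mem_right _ _ (Ideal.mul_mem_left _ _ ha))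
      ((hg.injective_iff hR ha ha0 hε).1 h)
  · constructor
    · intro hx
      obtain ⟨k, rfl⟩ := hε.exists_smul x
      rw [hg.apply] at hx
      obtain ⟨t, ht⟩ := (hε.smul_eq_zero _).1 hx
      refine ⟨op (↑q⁻¹ * t) • ε, ?_⟩
      rw [hfr.apply]
      congr 2
      rw [← Units.mul_right_inj p, ht, ← mul_assoc, hpq, mul_assoc, Units.mul_inv_cancel_left]
    · rintro ⟨y, rfl⟩
      obtain ⟨k, rfl⟩ := hε.exists_smul y
      rw [hfr.apply, hg.apply]
      exact (hε.smul_eq_zero _).2 ⟨q * k, by rw [← mul_assoc, hpq, mul_assoc]⟩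

theorem exists_injective_not_surjective (hR : IsNearlySimpleUniserialDomain R)
    (ha : a ∈ Ring.jacobson R) (ha0 : a ≠ 0) (hε : IsPresentedBy ε a) :
    ∃ f : Module.End Rᵐᵒᵖ X, Function.Injective f ∧ ¬ Function.Surjective f := by
  obtain ⟨x, hx, u, h⟩ := hR.exists_eq_mul_unit ha ha0 ha ha0
  obtain ⟨f, hf⟩ := hε.exists_end (r := x) (r' := ↑u⁻¹) (by
    nth_rewrite 2 [h]
    rw [Units.mul_inv_cancel_right])
  exact ⟨f, (hf.injective_iff hR ha ha0 hε).2 (Units.isUnit _),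
    fun h' => hR.mem_jacobson_iff.1 hx ((hf.surjective_iff hR ha hε).1 h')⟩

/-- The factor z itself induces an endomorphism: z a r' = z r a = t a = a t', and r' can be
inverted. -/
theorem exists_eq_mul_of_rep_eq_mul (hε : IsPresentedBy ε a) {f s : Module.End Rᵐᵒᵖ X}
    {r t t' z : R} {r' : Rˣ} (hf : Rep ε a f r r') (hs : Rep ε a s t t') (h : t = z * r) :
    ∃ y, s = y * f := by
  obtain ⟨y, hy⟩ := hε.exists_end (r := z) (r' := t' * ↑r'⁻¹) (by
    rw [← mul_assoc, ← hs.comm, h, mul_assoc z, hf.comm, mul_assoc z, Units.mul_inv_cancel_right])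
  exact ⟨y, hε.ext_rep hs (hy.mul hf) h⟩

theorem exists_eq_mul_of_rep_eq_mul' (hε : IsPresentedBy ε a) {g s : Module.End Rᵐᵒᵖ X}
    {r' t t' z : R} {r : Rˣ} (hg : Rep ε a g r r') (hs : Rep ε a s t t') (h : t' = r' * z) :
    ∃ y, s = g * y := by
  obtain ⟨y, hy⟩ := hε.exists_end (r := ↑r⁻¹ * t) (r' := z) (by
    rw [mul_assoc, hs.comm, h, ← mul_assoc a, ← hg.comm, mul_assoc, Units.inv_mul_cancel_left])
  exact ⟨y, hε.ext_rep hs (hg.mul hy) (by simp)⟩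

end IsPresentedBy

/-- If f + g were in `I`, then so would be f, because g is; likewise for `K` and g. -/
theorem isUnit_add (hR : IsNearlySimpleUniserialDomain R) (hX : IsCyclicallyPresentedTorsion R X)
    {f g : Module.End Rᵐᵒᵖ X} (hf : Function.Injective f) (hf' : ¬ Function.Surjective f)
    (hg : Function.Surjective g) (hg' : ¬ Function.Injective g) : IsUnit (f + g) := by
  refine (Module.End.isUnit_iff _).2 ⟨?_, ?_⟩
  · by_contra h
    have := (idealI hR hX).sub_mem (a := f + g) (b := g) h hg'
    rw [add_sub_cancel_right] at this
    exact this hf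
  · by_contra h
    have := (idealK hR hX).sub_mem (a := f + g) (b := f) h hf'
    rw [add_sub_cancel_left] at this
    exact this hg

/-- Non-epimorphisms factor through monomorphisms. -/
theorem exists_eq_mul_mono (hR : IsNearlySimpleUniserialDomain R)
    (hX : IsCyclicallyPresentedTorsion R X) {f s : Module.End Rᵐᵒᵖ X}
    (hf : Function.Injective f) (hs : ¬ Function.Surjective s) : ∃ y, s = y * f := by
  obtain ⟨ε, a, ha, ha0, hε⟩ := hX.exists_isPresentedBy
  have := hR.isDomain
  by_cases hs0 : s = 0
  · exact ⟨0, by simp [hs0]⟩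
  obtain ⟨r, r', hfr⟩ := hε.exists_rep f
  have hcomm := hfr.comm
  obtain ⟨r', rfl⟩ := (hfr.injective_iff hR ha ha0 hε).1 hf
  have hr0 : r ≠ 0 := by
    rintro rfl
    simp [ha0] at hcomm
  obtain ⟨t, t', hst⟩ := hε.exists_rep s
  rcases hR.comparable_left' r t with ⟨w, hw, h⟩ | ⟨w, h⟩
  swap
  · exact hε.exists_eq_mul_of_rep_eq_mul hfr hst h
  have hw0 : w ≠ 0 := by
    rintro rfl
    simp [hr0] at h
  -- Here r = w t goes the wrong way. The element x w induces a proper mono b with b s = y f. A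
  -- proper epi e killing the mono part of s makes v = b + e a unit with v s = b s, so s = v⁻¹ y f.
  obtain ⟨x, hx, u, hu⟩ := hR.exists_eq_mul_unit ha ha0 (Ideal.mul_mem_left _ w ha)
    (mul_ne_zero hw0 ha0)
  obtain ⟨b, hb⟩ := hε.exists_end (r := x * w) (r' := ↑u⁻¹) (by
    nth_rewrite 2 [hu]
    rw [Units.mul_inv_cancel_right, mul_assoc])
  obtain ⟨y, hy⟩ := hε.exists_eq_mul_of_rep_eq_mul hfr (hb.mul hst) (z := x)
    (by rw [h, mul_assoc])
  obtain ⟨x₀, w₀, hx₀, hw₀, rfl⟩ := hε.exists_factor hR ha ha0 hs0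
  obtain ⟨e, he, he'⟩ := hε.exists_isShortExact_right hR ha ha0 hx₀
    fun h' => hs (h'.comp hw₀)
  obtain ⟨v, hv⟩ := isUnit_add hR hX ((hb.injective_iff hR ha ha0 hε).2 (Units.isUnit _))
    (fun h' => hR.mem_jacobson_iff.1 (Ideal.mul_mem_left _ _ hw)
      ((hb.surjective_iff hR ha hε).1 h')) he'.2.2 he
  refine ⟨↑v⁻¹ * y, ?_⟩
  rw [mul_assoc, ← hy, Units.eq_inv_mul_iff_mul_eq, hv, add_mul, ← mul_assoc e,
    he'.exactPair.mul_eq_zero, zero_mul, add_zero]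

/-- Non-monomorphisms lift along epimorphisms. -/
theorem exists_eq_epi_mul (hR : IsNearlySimpleUniserialDomain R)
    (hX : IsCyclicallyPresentedTorsion R X) {g s : Module.End Rᵐᵒᵖ X}
    (hg : Function.Surjective g) (hs : ¬ Function.Injective s) : ∃ y, s = g * y := by
  obtain ⟨ε, a, ha, ha0, hε⟩ := hX.exists_isPresentedBy
  have := hR.isDomain
  by_cases hs0 : s = 0
  · exact ⟨0, by simp [hs0]⟩
  obtain ⟨r, r', hgr⟩ := hε.exists_rep g
  have hcomm := hgr.comm
  obtain ⟨r, rfl⟩ := (hgr.surjective_iff hR ha hε).1 hg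
  have hr0 : r' ≠ 0 := by
    rintro rfl
    simp [ha0] at hcomm
  obtain ⟨t, t', hst⟩ := hε.exists_rep s
  rcases hR.comparable_right' r' t' with ⟨w, hw, h⟩ | ⟨w, h⟩
  swap
  · exact hε.exists_eq_mul_of_rep_eq_mul' hgr hst h
  have hw0 : w ≠ 0 := by
    rintro rfl
    simp [hr0] at h
  -- Dually, b is a proper epi with s b = g y, and e is a proper mono killed by the epi part of s;
  -- then s (e + b) = g y.
  obtain ⟨x, hx, u, hu⟩ := hR.exists_eq_unit_mul ha ha0 (Ideal.mul_mem_right w _ ha)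
    (mul_ne_zero ha0 hw0)
  obtain ⟨b, hb⟩ := hε.exists_end (r := ↑u⁻¹) (r' := w * x) (by
    nth_rewrite 1 [hu]
    rw [mul_assoc (u : R), Units.inv_mul_cancel_left, mul_assoc])
  obtain ⟨y, hy⟩ := hε.exists_eq_mul_of_rep_eq_mul' hgr (hst.mul hb) (z := x)
    (by rw [h, mul_assoc])
  obtain ⟨w₀, x₀, hw₀, hx₀, rfl⟩ := hε.exists_factor hR ha ha0 hs0
  obtain ⟨e, he, he'⟩ := hε.exists_isShortExact_left hR ha ha0 hx₀
    fun h' => hs (hw₀.comp h')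
  obtain ⟨v, hv⟩ := isUnit_add hR hX he'.1 he ((hb.surjective_iff hR ha hε).2 (Units.isUnit _))
    (fun h' => hR.mem_jacobson_iff.1 (Ideal.mul_mem_left _ _ hx)
      ((hb.injective_iff hR ha ha0 hε).1 h'))
  refine ⟨y * ↑v⁻¹, ?_⟩
  rw [← mul_assoc, ← hy, Units.eq_mul_inv_iff_mul_eq, hv, mul_add, mul_assoc w₀ x₀ e,
    he'.exactPair.mul_eq_zero, mul_zero, zero_add]

theorem isDPPair (hR : IsNearlySimpleUniserialDomain R) (hX : IsCyclicallyPresentedTorsion R X) :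
    IsDPPair (idealI hR hX) (idealK hR hX) := by
  obtain ⟨ε, a, ha, ha0, hε⟩ := hX.exists_isPresentedBy
  have memI : ∀ {s}, s ∉ idealI hR hX → Function.Injective s := fun h => not_not.1 h
  have memK : ∀ {s}, s ∉ idealK hR hX → Function.Surjective s := fun h => not_not.1 h
  refine
    { one_notMem_I := fun h => h Function.injective_id
      one_notMem_K := fun h => h Function.surjective_id
      mul_mem_I := fun s hs t h => ?_
      mul_mem_K := fun s hs t h => hs (Function.Surjective.of_comp (g := t) h)
      prime_I := fun s t hs ht h => h ((memI hs).comp (memI ht))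
      prime_K := fun s t hs ht h => h ((memK hs).comp (memK ht))
      isUnit := fun s hs hs' => (Module.End.isUnit_iff _).2 ⟨memI hs, memK hs'⟩
      factor := fun s hs => ?_
      cancel_I := fun f t hf h => ?_
      cancel_K := fun g t hg h => ?_
      eq_mul_of_mem_K := fun f hf s hs => exists_eq_mul_mono hR hX (memI hf) hs
      eq_mul_of_mem_I := fun g hg s hs => exists_eq_epi_mul hR hX (memK hg) hs
      exists_left := fun g hg hg' => ?_
      exists_right := fun f hf hf' => ?_
      comparable := fun g h hg hh => ?_
      exists_mono := ?_ }
  -- In a uniserial module the nonzero kernel of s meets the nonzero range of t.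
  · have ht : Function.Injective t := Function.Injective.of_comp (f := s) h
    have := hX.nontrivial hR
    obtain ⟨x, hx⟩ := exists_ne (0 : X)
    have hs' : LinearMap.ker s ≠ ⊥ := fun e => hs (LinearMap.ker_eq_bot.1 e)
    obtain ⟨y, hy, hy0⟩ := (Submodule.ne_bot_iff _).1 hs'
    rcases hX.isUniserial hR (LinearMap.ker s) (LinearMap.range t) with h' | h'
    · obtain ⟨z, rfl⟩ := h' hy
      have hz : z = 0 := h (by simpa using hy)
      simp [hz] at hy0
    · have hx' : s (t x) = 0 := h' ⟨x, rfl⟩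
      exact hx (h (by simpa using hx'))
  · obtain ⟨f, g, hf, hg, h⟩ := hε.exists_factor hR ha ha0 hs
    exact ⟨f, g, not_not.2 hf, not_not.2 hg, h⟩
  · ext x
    exact memI hf ((LinearMap.congr_fun h x).trans (map_zero f).symm)
  · ext x
    obtain ⟨y, rfl⟩ := memK hg x
    exact LinearMap.congr_fun h y
  · obtain ⟨f, hf, h⟩ := hε.exists_isShortExact_left hR ha ha0 (memK hg') hg
    exact ⟨f, hf, not_not.2 h.1, h.exactPair⟩
  · obtain ⟨g, hg, h⟩ := hε.exists_isShortExact_right hR ha ha0 (memI hf') hf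
    exact ⟨g, hg, not_not.2 h.2.2, h.exactPair⟩
  · rcases hX.isUniserial hR (LinearMap.ker g) (LinearMap.ker h) with h' | h'
    · exact Or.inr (exists_eq_mul_of_ker_le (memK hg) h')
    · exact Or.inl (exists_eq_mul_of_ker_le (memK hh) h')
  · obtain ⟨f, hf, hf'⟩ := hε.exists_injective_not_surjective hR ha ha0
    exact ⟨f, hf', not_not.2 hf⟩

theorem exists_isShortExact (hR : IsNearlySimpleUniserialDomain R)
    (hX : IsCyclicallyPresentedTorsion R X) :
    ∃ f g : Module.End Rᵐᵒᵖ X, IsShortExact f g := by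
  obtain ⟨ε, a, ha, ha0, hε⟩ := hX.exists_isPresentedBy
  obtain ⟨f, hf, hf'⟩ := hε.exists_injective_not_surjective hR ha ha0
  obtain ⟨g, -, h⟩ := hε.exists_isShortExact_right hR ha ha0 hf hf'
  exact ⟨f, g, h⟩

namespace IsShortExact

variable {f g : Module.End Rᵐᵒᵖ X}

theorem left_notMem_I (h : IsShortExact f g) (hR : IsNearlySimpleUniserialDomain R)
    (hX : IsCyclicallyPresentedTorsion R X) : f ∉ idealI hR hX :=
  not_not.2 h.1

theorem right_notMem_K (h : IsShortExact f g) (hR : IsNearlySimpleUniserialDomain R)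
    (hX : IsCyclicallyPresentedTorsion R X) : g ∉ idealK hR hX :=
  not_not.2 h.2.2

theorem left_mem_K (h : IsShortExact f g) (hR : IsNearlySimpleUniserialDomain R)
    (hX : IsCyclicallyPresentedTorsion R X) : f ∈ idealK hR hX := by
  by_contra hf
  refine h.right_notMem_K hR hX ?_
  rw [(isDPPair hR hX).cancel_K f g hf h.exactPair.mul_eq_zero]
  exact zero_mem _

theorem right_mem_I (h : IsShortExact f g) (hR : IsNearlySimpleUniserialDomain R)
    (hX : IsCyclicallyPresentedTorsion R X) : g ∈ idealI hR hX := by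
  by_contra hg
  refine h.left_notMem_I hR hX ?_
  rw [(isDPPair hR hX).cancel_I g f hg h.exactPair.mul_eq_zero]
  exact zero_mem _

end IsShortExact

end Endomorphisms

/-! ### Arithmetic of the ring S -/

namespace IsDPPair

variable {S : Type u} [Ring S] {I K : Ideal S}

theorem isUnit_add (h : IsDPPair I K) {f g : S} (hf : f ∈ K) (hf' : f ∉ I) (hg : g ∈ I)
    (hg' : g ∉ K) : IsUnit (f + g) := by
  refine h.isUnit _ (fun h' => hf' ?_) fun h' => hg' ?_
  · simpa using I.sub_mem h' hg
  · simpa using K.sub_mem h' hf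

theorem exists_epi (h : IsDPPair I K) : ∃ g ∈ I, g ∉ K := by
  obtain ⟨f, hf, hf'⟩ := h.exists_mono
  obtain ⟨g, hg, hg', -⟩ := h.exists_right f hf hf'
  exact ⟨g, hg, hg'⟩

theorem exists_left_inverse_mod_K (h : IsDPPair I K) {x : S} (hx : x ∉ K) :
    ∃ z ∈ I, 1 - z * x ∈ K := by
  obtain ⟨e, he, he'⟩ := h.exists_epi
  obtain ⟨f, hf, hf'⟩ := h.exists_mono
  obtain ⟨u, hu⟩ := h.isUnit_add hf hf' (h.mul_mem_I e he x) (h.prime_K e x he' hx)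
  refine ⟨↑u⁻¹ * e, I.mul_mem_left _ he, ?_⟩
  have : 1 - ↑u⁻¹ * e * x = ↑u⁻¹ * f := by
    rw [sub_eq_iff_eq_add, mul_assoc, ← mul_add, ← hu, Units.inv_mul]
  rw [this]
  exact K.mul_mem_left _ hf

/-- If g ∈ I has kernel f and u = f + g, any solution v may be replaced by g u⁻¹ v = v - f u⁻¹ v,
which differs from v by something g kills. -/
theorem exists_eq_mul_mem_I (h : IsDPPair I K) {g s : S} (hg : g ∉ K) (hs : s ∈ I) :
    ∃ v ∈ I, s = g * v := by
  obtain ⟨v, hv⟩ := h.eq_mul_of_mem_I g hg s hs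
  by_cases hgI : g ∈ I
  · obtain ⟨f, hf, hf', hfg⟩ := h.exists_left g hgI hg
    obtain ⟨u, hu⟩ := h.isUnit_add hf hf' hgI hg
    refine ⟨g * (↑u⁻¹ * v), h.mul_mem_I g hgI _, ?_⟩
    have hv' : g * (↑u⁻¹ * v) = v - f * (↑u⁻¹ * v) := by
      rw [eq_sub_iff_add_eq, add_comm, ← add_mul, ← hu, Units.mul_inv_cancel_left]
    rw [hv', mul_sub, ← mul_assoc g f, hfg.mul_eq_zero, zero_mul, sub_zero, hv]
  · obtain ⟨g, rfl⟩ := h.isUnit g hgI hg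
    exact ⟨↑g⁻¹ * s, I.mul_mem_left _ hs, by simp⟩

theorem exists_eq_mul_mem_J (h : IsDPPair I K) {f s : S} (hf : f ∈ K) (hf' : f ∉ I) (hs : s ∈ I)
    (hs' : s ∈ K) : ∃ v ∈ I, v ∈ K ∧ s = v * f := by
  obtain ⟨v, hv⟩ := h.eq_mul_of_mem_K f hf' s hs'
  obtain ⟨g, hg, hg', hfg⟩ := h.exists_right f hf hf'
  obtain ⟨u, hu⟩ := h.isUnit_add hf hf' hg hg'
  have hv' : v * ↑u⁻¹ * f = v - v * ↑u⁻¹ * g := by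
    rw [eq_sub_iff_add_eq, ← mul_add, ← hu, Units.inv_mul_cancel_right]
  have key : s = v * ↑u⁻¹ * f * f := by
    rw [hv', sub_mul, mul_assoc _ g f, hfg.mul_eq_zero, mul_zero, sub_zero, hv]
  refine ⟨v * ↑u⁻¹ * f, ?_, K.mul_mem_left _ hf, key⟩
  by_contra h'
  exact h.prime_I _ _ h' hf' (key ▸ hs)

theorem mem_I_of_mul_mem (h : IsDPPair I K) {f s : S} (hf : f ∉ I) (hs : f * s ∈ I) : s ∈ I := by
  by_contra h'
  exact h.prime_I _ _ hf h' hs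

theorem mul_left_cancel (h : IsDPPair I K) {f s t : S} (hf : f ∉ I) (hs : f * s = f * t) :
    s = t :=
  sub_eq_zero.1 (h.cancel_I f _ hf (by rw [mul_sub, hs, sub_self]))

theorem mul_right_cancel (h : IsDPPair I K) {g s t : S} (hg : g ∉ K) (hs : s * g = t * g) :
    s = t :=
  sub_eq_zero.1 (h.cancel_K g _ hg (by rw [sub_mul, hs, sub_self]))

/-- Elements of `I` are proper multiples of epimorphisms in `I`. -/
theorem exists_eq_mul_epi (h : IsDPPair I K) {s : S} (hs : s ∈ I) :
    ∃ t ∈ I, t ∉ K ∧ ∃ y ∈ I, s = y * t := by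
  by_cases hs0 : s = 0
  · obtain ⟨t, ht, ht'⟩ := h.exists_epi
    exact ⟨t, ht, ht', 0, zero_mem _, by simp [hs0]⟩
  obtain ⟨f₁, g₁, hf₁, hg₁, rfl⟩ := h.factor s hs0
  have hg₁I : g₁ ∈ I := h.mem_I_of_mul_mem hf₁ hs
  obtain ⟨f, hf, hf', hfg⟩ := h.exists_left g₁ hg₁I hg₁
  -- The kernel of t is the image of f², strictly inside the image of f, which is the kernel of g₁.
  -- So g₁ factors through t by a map y that cannot be mono.
  obtain ⟨t, ht, ht', hft⟩ := h.exists_right (f * f) (K.mul_mem_left _ hf) (h.prime_I _ _ hf' hf')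
  obtain ⟨y, hy⟩ := hft.eq_mul_of_mul_eq_zero g₁
    (by rw [← mul_assoc, hfg.mul_eq_zero, zero_mul])
  refine ⟨t, ht, ht', f₁ * y, I.mul_mem_left _ ?_, by rw [hy, mul_assoc]⟩
  by_contra hyI
  have h0 : t * f = 0 := by
    refine h.cancel_I y _ hyI ?_
    rw [← mul_assoc, ← hy, hfg.mul_eq_zero]
  obtain ⟨w, hw⟩ := hft.eq_mul_of_mul_eq_zero' f h0
  have h1 : 1 = f * w := by
    refine h.mul_left_cancel hf' ?_
    rw [mul_one, ← mul_assoc, ← hw]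
  exact h.one_notMem_K (h1 ▸ h.mul_mem_K f hf w)

theorem exists_common_epi (h : IsDPPair I K) {s s' : S} (hs : s ∈ I) (hs' : s' ∈ I) :
    ∃ t ∈ I, t ∉ K ∧ (∃ y ∈ I, s = y * t) ∧ ∃ y ∈ I, s' = y * t := by
  obtain ⟨t, ht, htK, y, hy, rfl⟩ := h.exists_eq_mul_epi hs
  obtain ⟨t', ht', htK', y', hy', rfl⟩ := h.exists_eq_mul_epi hs'
  rcases h.comparable t t' htK htK' with ⟨z, rfl⟩ | ⟨z, rfl⟩
  · exact ⟨t', ht', htK', ⟨y * z, h.mul_mem_I y hy z, by rw [mul_assoc]⟩, y', hy', rfl⟩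
  · exact ⟨t, ht, htK, ⟨y, hy, rfl⟩, y' * z, h.mul_mem_I y' hy' z, by rw [mul_assoc]⟩

/-- Left ideals with two generators are principal. As epis are comparable, the generators become f g
and k g with f mono. Then one is a left multiple of the other, unless f is a proper mono and k a
proper epi; in that case f + k is a unit and g generates. -/
theorem exists_generator (h : IsDPPair I K) (x y : S) :
    ∃ d, (∃ p, x = p * d) ∧ (∃ q, y = q * d) ∧ ∃ p q, d = p * x + q * y := by
  have of_mem : ∀ {x y p : S}, y = p * x →
      ∃ d, (∃ p, x = p * d) ∧ (∃ q, y = q * d) ∧ ∃ p q, d = p * x + q * y := fun {x y p} hp =>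
    ⟨x, ⟨1, by simp⟩, ⟨p, hp⟩, 1, 0, by simp⟩
  have symm : ∀ {x y : S},
      (∃ d, (∃ p, y = p * d) ∧ (∃ q, x = q * d) ∧ ∃ p q, d = p * y + q * x) →
      ∃ d, (∃ p, x = p * d) ∧ (∃ q, y = q * d) ∧ ∃ p q, d = p * x + q * y :=
    fun {x y} ⟨d, h₁, h₂, p, q, h₃⟩ => ⟨d, h₂, h₁, q, p, by rw [h₃, add_comm]⟩
  have main : ∀ f k g : S, f ∉ I → ∃ d, (∃ p, f * g = p * d) ∧ (∃ q, k * g = q * d) ∧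
      ∃ p q, d = p * (f * g) + q * (k * g) := by
    intro f k g hf
    by_cases hk : k ∈ K
    · obtain ⟨y, rfl⟩ := h.eq_mul_of_mem_K f hf k hk
      exact of_mem (p := y) (by rw [mul_assoc])
    by_cases hf' : f ∈ K
    · by_cases hk' : k ∈ I
      · obtain ⟨u, hu⟩ := h.isUnit_add hf' hf hk' hk
        refine ⟨g, ⟨f, rfl⟩, ⟨k, rfl⟩, ↑u⁻¹, ↑u⁻¹, ?_⟩
        rw [← mul_add, ← add_mul, ← hu, Units.inv_mul_cancel_left]
      · obtain ⟨k, rfl⟩ := h.isUnit k hk' hk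
        exact symm (of_mem (p := f * ↑k⁻¹) (by simp [mul_assoc]))
    · obtain ⟨f, rfl⟩ := h.isUnit f hf hf'
      exact of_mem (p := k * ↑f⁻¹) (by simp [mul_assoc])
  by_cases hx : x = 0
  · exact symm (of_mem (p := 0) (by simp [hx]))
  by_cases hy : y = 0
  · exact of_mem (p := 0) (by simp [hy])
  obtain ⟨f, g, hf, hg, rfl⟩ := h.factor x hx
  obtain ⟨f', g', hf', hg', rfl⟩ := h.factor y hy
  rcases h.comparable g g' hg hg' with ⟨z, rfl⟩ | ⟨z, rfl⟩
  · have := main f' (f * z) g' hf'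
    rw [mul_assoc f z] at this
    exact symm this
  · have := main f (f' * z) g hf
    rwa [mul_assoc f' z] at this

/-- Elements of `I` are comparable modulo `I g`. -/
theorem comparable_mod (h : IsDPPair I K) {g s t : S} (hg' : g ∉ K)
    (hs : s ∈ I) (ht : t ∈ I) :
    (∃ x, ∃ z ∈ I, s - x * t = z * g) ∨ ∃ x, ∃ z ∈ I, t - x * s = z * g := by
  have main : ∀ f₁ f₂ y g₁ : S, f₁ ∉ I → f₂ ∉ I → g₁ ∉ K → y ∉ K →
      (∃ x, ∃ z ∈ I, f₁ * g₁ - x * (f₂ * (y * g₁)) = z * g) ∨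
        ∃ x, ∃ z ∈ I, f₂ * (y * g₁) - x * (f₁ * g₁) = z * g := by
    intro f₁ f₂ y g₁ hf₁ hf₂ hg₁ hy
    by_cases hf₁K : f₁ ∈ K
    swap
    · obtain ⟨f₁, rfl⟩ := h.isUnit f₁ hf₁ hf₁K
      exact Or.inr ⟨f₂ * y * ↑f₁⁻¹, 0, zero_mem _, by simp [mul_assoc]⟩
    by_cases hf₂K : f₂ ∈ K
    · obtain ⟨x, hx⟩ := h.eq_mul_of_mem_K f₁ hf₁ (f₂ * y) (h.mul_mem_K f₂ hf₂K y)
      exact Or.inr ⟨x, 0, zero_mem _, by rw [← mul_assoc f₂, hx]; simp [mul_assoc]⟩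
    obtain ⟨f₂, rfl⟩ := h.isUnit f₂ hf₂ hf₂K
    by_cases hyI : y ∈ I
    swap
    · obtain ⟨y, rfl⟩ := h.isUnit y hyI hy
      exact Or.inl ⟨f₁ * ↑y⁻¹ * ↑f₂⁻¹, 0, zero_mem _, by simp [mul_assoc]⟩
    have htK : (f₂ : S) * (y * g₁) ∉ K :=
      h.prime_K _ _ hf₂K (h.prime_K _ _ hy hg₁)
    -- The remaining case: f₁ is a proper mono and t = f₂ y g₁ is epi. If g = x t, take z in I with
    -- 1 - z x ∈ K; then t - z g = (1 - z x) t is a left multiple of f₁ g₁, because 1 - z x absorbs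
    -- a factor f₁.
    have of_eq : ∀ x, x ∉ K → g = x * (f₂ * (y * g₁)) →
        ∃ x, ∃ z ∈ I, f₂ * (y * g₁) - x * (f₁ * g₁) = z * g := by
      intro x hx hgx
      obtain ⟨z, hz, hzK⟩ := h.exists_left_inverse_mod_K hx
      obtain ⟨w, hw⟩ := h.eq_mul_of_mem_K f₁ hf₁ ((1 - z * x) * (f₂ * y))
        (h.mul_mem_K _ hzK _)
      refine ⟨w, z, hz, ?_⟩
      rw [hgx, ← mul_assoc w, ← hw]
      noncomm_ring
    rcases h.comparable g (f₂ * (y * g₁)) hg' htK with ⟨x, hx⟩ | ⟨x, hx⟩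
    · exact Or.inr (of_eq x (fun hxK => hg' (hx ▸ h.mul_mem_K x hxK _)) hx)
    · by_cases hxI : x ∈ I
      · exact Or.inr ⟨0, x, hxI, by rw [zero_mul, sub_zero, hx]⟩
      · obtain ⟨x, rfl⟩ := h.isUnit x hxI fun hxK => htK (hx ▸ h.mul_mem_K x hxK _)
        have hx' : ((x⁻¹ : Sˣ) : S) ∉ K := fun hK =>
          h.one_notMem_K (by simpa using K.mul_mem_left (x : S) hK)
        exact Or.inr (of_eq ↑x⁻¹ hx' (by rw [hx, Units.inv_mul_cancel_left]))
  by_cases hs0 : s = 0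
  · exact Or.inl ⟨0, 0, zero_mem _, by simp [hs0]⟩
  by_cases ht0 : t = 0
  · exact Or.inr ⟨0, 0, zero_mem _, by simp [ht0]⟩
  obtain ⟨f₁, g₁, hf₁, hg₁, rfl⟩ := h.factor s hs0
  obtain ⟨f₂, g₂, hf₂, hg₂, rfl⟩ := h.factor t ht0
  rcases h.comparable g₁ g₂ hg₁ hg₂ with ⟨z, rfl⟩ | ⟨z, rfl⟩
  · exact (main f₂ f₁ z g₂ hf₂ hf₁ hg₂ fun hz => hg₁ (h.mul_mem_K z hz g₂)).symm
  · exact main f₁ f₂ z g₁ hf₁ hf₂ hg₁ fun hz => hg₂ (h.mul_mem_K z hz g₁)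

end IsDPPair

/-! ### Criteria for uniserial and flat modules -/

section Criteria

variable {S : Type u} [Ring S]

theorem isUniserial_of_comparable {M : Type v} [AddCommGroup M] [Module S M]
    (h : ∀ x y : M, (∃ a : S, x = a • y) ∨ ∃ a : S, y = a • x) : IsUniserial S M := by
  intro N P
  by_contra! hNP
  obtain ⟨x, hx, hx'⟩ := SetLike.not_le_iff_exists.1 hNP.1
  obtain ⟨y, hy, hy'⟩ := SetLike.not_le_iff_exists.1 hNP.2
  rcases h x y with ⟨a, rfl⟩ | ⟨a, rfl⟩
  · exact hx' (P.smul_mem _ hy)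
  · exact hy' (N.smul_mem _ hx)

/-! ### A criterion for flatness -/

section Flat

section CoeffEval

variable {M : Type v} {N : Type w} [AddCommGroup N] [Module Sᵐᵒᵖ N]

/-- Evaluation of a formal sum of pairs `(m, n)` at a coefficient function. -/
noncomputable def coeffEval (N : Type w) [AddCommGroup N] [Module Sᵐᵒᵖ N] (b : M → S) :
    (M →₀ N) →+ N :=
  Finsupp.liftAddHom fun m => DistribSMul.toAddMonoidHom N (op (b m))

@[simp]
theorem coeffEval_single (b : M → S) (m : M) (n : N) :
    coeffEval N b (Finsupp.single m n) = op (b m) • n := by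
  simp [coeffEval]

theorem coeffEval_mul (b b' : M → S) (c : S) (z : M →₀ N)
    (h : ∀ m ∈ z.support, b' m = b m * c) :
    coeffEval N b' z = op c • coeffEval N b z := by
  simp only [coeffEval, Finsupp.liftAddHom_apply, Finsupp.sum, Finset.smul_sum]
  refine Finset.sum_congr rfl fun m hm => ?_
  simp [h m hm, mul_smul]

end CoeffEval

variable {M : Type v} [AddCommGroup M] [Module S M]

theorem exists_common_generator (hdir : ∀ x y : M, ∃ (p : M) (a b : S), x = a • p ∧ y = b • p)
    (T : Finset M) : ∃ (p : M) (b : M → S), ∀ m ∈ T, m = b m • p := by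
  classical
  induction T using Finset.induction_on with
  | empty => exact ⟨0, 0, by simp⟩
  | insert x T _ ih =>
    obtain ⟨p, b, hb⟩ := ih
    obtain ⟨q, a, c, h₁, h₂⟩ := hdir x p
    refine ⟨q, fun m => if m = x then a else b m * c, fun m hm => ?_⟩
    by_cases hmx : m = x
    · simp [hmx, ← h₁]
    · simp only [hmx, if_false]
      rw [mul_smul, ← h₂]
      exact hb m (Finset.mem_of_mem_insert_of_ne hm hmx)

theorem exists_common_annihilator
    (hann : ∀ (d : S) (p : M), d • p = 0 → ∃ (b : S) (p' : M), p = b • p' ∧ d * b = 0)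
    (D : Finset S) (p : M) (hD : ∀ d ∈ D, d • p = 0) :
    ∃ (e : S) (p' : M), p = e • p' ∧ ∀ d ∈ D, d * e = 0 := by
  classical
  induction D using Finset.induction_on with
  | empty => exact ⟨1, p, by simp⟩
  | insert d D _ ih =>
    obtain ⟨e, p', rfl, he⟩ := ih fun x hx => hD x (Finset.mem_insert_of_mem hx)
    obtain ⟨b, q, rfl, hb⟩ := hann (d * e) p' (by
      rw [mul_smul]
      exact hD d (Finset.mem_insert_self _ _))
    refine ⟨e * b, q, by rw [mul_smul], fun x hx => ?_⟩
    rcases Finset.mem_insert.1 hx with rfl | hx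
    · rw [← mul_assoc, hb]
    · rw [← mul_assoc, he x hx, zero_mul]

variable {N : Type w} [AddCommGroup N] [Module Sᵐᵒᵖ N]

/-- The formal sums that vanish after writing all occurring `m` as multiples of one element. -/
def coeffRel (hdir : ∀ x y : M, ∃ (p : M) (a b : S), x = a • p ∧ y = b • p)
    (hann : ∀ (d : S) (p : M), d • p = 0 → ∃ (b : S) (p' : M), p = b • p' ∧ d * b = 0)
    (N : Type w) [AddCommGroup N] [Module Sᵐᵒᵖ N] : AddSubgroup (M →₀ N) where
  carrier := {z | ∃ (T : Finset M) (p : M) (b : M → S), z.support ⊆ T ∧ (∀ m ∈ T, m = b m • p) ∧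
    coeffEval N b z = 0}
  zero_mem' := ⟨∅, 0, 0, by simp⟩
  neg_mem' := by
    rintro z ⟨T, p, b, h₁, h₂, h₃⟩
    exact ⟨T, p, b, by simpa using h₁, h₂, by rw [map_neg, h₃, neg_zero]⟩
  add_mem' := by
    classical
    rintro z₁ z₂ ⟨T₁, p₁, b₁, h₁, h₂, h₃⟩ ⟨T₂, p₂, b₂, h₁', h₂', h₃'⟩
    obtain ⟨p, c₁, c₂, rfl, rfl⟩ := hdir p₁ p₂
    obtain ⟨q, b, hb⟩ := exists_common_generator hdir (insert p (T₁ ∪ T₂))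
    have hp := hb p (Finset.mem_insert_self _ _)
    -- The coefficients over q and those inherited from p₁, p₂ agree only up to annihilators of q.
    -- Passing to q' with q = e q' makes them agree exactly.
    obtain ⟨e, q', rfl, he⟩ := exists_common_annihilator hann
      (T₁.image (fun m => b m - b₁ m * c₁ * b p) ∪ T₂.image (fun m => b m - b₂ m * c₂ * b p)) q (by
        intro d hd
        simp only [Finset.mem_union, Finset.mem_image] at hd
        rcases hd with ⟨m, hm, rfl⟩ | ⟨m, hm, rfl⟩
        · rw [sub_smul, ← hb m (by simp [hm]), mul_smul, ← hp, mul_smul, ← h₂ m hm, sub_self]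
        · rw [sub_smul, ← hb m (by simp [hm]), mul_smul, ← hp, mul_smul, ← h₂' m hm, sub_self])
    refine ⟨T₁ ∪ T₂, q', fun m => b m * e, ?_, fun m hm => ?_, ?_⟩
    · exact Finsupp.support_add.trans (Finset.union_subset_union h₁ h₁')
    · rw [mul_smul]
      exact hb m (Finset.mem_insert_of_mem hm)
    · rw [map_add, coeffEval_mul b₁ _ (c₁ * b p * e), h₃, coeffEval_mul b₂ _ (c₂ * b p * e), h₃',
        smul_zero, smul_zero, add_zero]
      · intro m hm
        rw [← sub_eq_zero, ← he _ (Finset.mem_union_right _ (Finset.mem_image_of_mem _ (h₁' hm)))]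
        noncomm_ring
      · intro m hm
        rw [← sub_eq_zero, ← he _ (Finset.mem_union_left _ (Finset.mem_image_of_mem _ (h₁ hm)))]
        noncomm_ring

/-- The sum stands for n ⊗ d p = 0. Writing p = e p' with d e = 0 turns the value n d into n d e =
0. -/
theorem mem_coeffRel
    (hdir : ∀ x y : M, ∃ (p : M) (a b : S), x = a • p ∧ y = b • p)
    (hann : ∀ (d : S) (p : M), d • p = 0 → ∃ (b : S) (p' : M), p = b • p' ∧ d * b = 0)
    {z : M →₀ N} {T : Finset M} {p : M} {b : M → S} {d : S} {n : N}
    (hz : z.support ⊆ T) (hb : ∀ m ∈ T, m = b m • p) (hd : d • p = 0)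
    (h : coeffEval N b z = op d • n) : z ∈ coeffRel hdir hann N := by
  obtain ⟨e, p', rfl, he⟩ := hann d p hd
  refine ⟨T, p', fun m => b m * e, hz, fun m hm => ?_, ?_⟩
  · rw [mul_smul]
    exact hb m hm
  · rw [coeffEval_mul b _ e z fun _ _ => rfl, h, smul_smul, ← MulOpposite.op_mul, he,
      MulOpposite.op_zero, zero_smul]

/-- The map that sends `n ⊗ m` to the class of the formal pair. -/
noncomputable def tensorToCoeff
    (hdir : ∀ x y : M, ∃ (p : M) (a b : S), x = a • p ∧ y = b • p)
    (hann : ∀ (d : S) (p : M), d • p = 0 → ∃ (b : S) (p' : M), p = b • p' ∧ d * b = 0)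
    (N : Type w) [AddCommGroup N] [Module Sᵐᵒᵖ N] :
    N ⊗[ℤ] M →+ (M →₀ N) ⧸ coeffRel hdir hann N :=
  TensorProduct.liftAddHom
    (AddMonoidHom.mk' (fun n => AddMonoidHom.mk'
        (fun m => QuotientAddGroup.mk (Finsupp.single m n)) (by
          classical
          intro x y
          rw [← QuotientAddGroup.mk_add, QuotientAddGroup.eq]
          obtain ⟨p, b, hb⟩ := exists_common_generator hdir {x, y, x + y}
          refine mem_coeffRel hdir hann (T := {x, y, x + y}) (d := b x + b y - b (x + y)) (n := n)
            ?_ hb ?_ ?_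
          · refine Finsupp.support_add.trans (Finset.union_subset ?_
              (Finsupp.support_add.trans (Finset.union_subset ?_ ?_)))
            · rw [Finsupp.support_neg]
              exact Finsupp.support_single_subset.trans (by simp)
            · exact Finsupp.support_single_subset.trans (by simp)
            · exact Finsupp.support_single_subset.trans (by simp)
          · rw [sub_smul, add_smul, ← hb x (by simp), ← hb y (by simp), ← hb (x + y) (by simp),
              sub_self]
          · rw [map_add, map_neg, map_add, coeffEval_single, coeffEval_single, coeffEval_single,
              MulOpposite.op_sub, MulOpposite.op_add, sub_smul, add_smul]
            abel))
      (by
        intro n n'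
        ext m
        simp [Finsupp.single_add]))
    (by
      intro r n m
      exact (DFunLike.congr_fun (map_zsmul _ r n) m).trans (map_zsmul _ r m).symm)

theorem tensorToCoeff_tmul
    (hdir : ∀ x y : M, ∃ (p : M) (a b : S), x = a • p ∧ y = b • p)
    (hann : ∀ (d : S) (p : M), d • p = 0 → ∃ (b : S) (p' : M), p = b • p' ∧ d * b = 0)
    (n : N) (m : M) :
    tensorToCoeff hdir hann N (n ⊗ₜ[ℤ] m) = QuotientAddGroup.mk (Finsupp.single m n) :=
  rfl

/-- The equational criterion for a vanishing tensor n ⊗ p: balanced relations die in the quotient of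
formal sums by `coeffRel`, and membership of the single pair there is the desired data. -/
theorem exists_of_tmul_mem_balancedRel
    (hdir : ∀ x y : M, ∃ (p : M) (a b : S), x = a • p ∧ y = b • p)
    (hann : ∀ (d : S) (p : M), d • p = 0 → ∃ (b : S) (p' : M), p = b • p' ∧ d * b = 0)
    {n : N} {p : M} (h : n ⊗ₜ[ℤ] p ∈ balancedRel S N M) :
    ∃ (b : S) (p' : M), p = b • p' ∧ op b • n = 0 := by
  classical
  have hle : balancedRel S N M ≤
      LinearMap.ker (tensorToCoeff hdir hann N).toIntLinearMap := by
    refine Submodule.span_le.2 ?_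
    rintro _ ⟨n, s, m, rfl⟩
    rw [SetLike.mem_coe, LinearMap.mem_ker, AddMonoidHom.coe_toIntLinearMap, map_sub, tensorToCoeff_tmul, tensorToCoeff_tmul, sub_eq_zero, eq_comm, QuotientAddGroup.eq]
    obtain ⟨p, b, hb⟩ := exists_common_generator hdir {m, s • m}
    refine mem_coeffRel hdir hann (T := {m, s • m}) (d := s * b m - b (s • m)) (n := n) ?_ hb ?_ ?_
    · refine Finsupp.support_add.trans (Finset.union_subset ?_ ?_)
      · rw [Finsupp.support_neg]
        exact Finsupp.support_single_subset.trans (by simp)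
      · exact Finsupp.support_single_subset.trans (by simp)
    · rw [sub_smul, ← hb (s • m) (by simp), mul_smul, ← hb m (by simp), sub_self]
    · rw [map_add, map_neg, coeffEval_single, coeffEval_single, smul_smul, ← MulOpposite.op_mul,
        MulOpposite.op_sub, sub_smul]
      abel
  have h0 : tensorToCoeff hdir hann N (n ⊗ₜ[ℤ] p) = 0 := hle h
  rw [tensorToCoeff_tmul, QuotientAddGroup.eq_zero_iff] at h0
  obtain ⟨T, p', b, h₁, h₂, h₃⟩ := h0
  by_cases hn : n = 0
  · exact ⟨1, p, by simp [hn]⟩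
  · rw [coeffEval_single] at h₃
    exact ⟨b p, p', h₂ p (h₁ (by simp [hn])), h₃⟩

theorem exists_tmul_sub_mem_balancedRel
    (hdir : ∀ x y : M, ∃ (p : M) (a b : S), x = a • p ∧ y = b • p)
    (t : N ⊗[ℤ] M) :
    ∃ n p, t - n ⊗ₜ[ℤ] p ∈ balancedRel S N M := by
  induction t with
  | zero => exact ⟨0, 0, by simp⟩
  | tmul n p => exact ⟨n, p, by simp⟩
  | add x y hx hy =>
    obtain ⟨n, p, h⟩ := hx
    obtain ⟨n', p', h'⟩ := hy
    obtain ⟨q, a, b, rfl, rfl⟩ := hdir p p'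
    refine ⟨op a • n + op b • n', q, ?_⟩
    have h₁ : (op a • n) ⊗ₜ[ℤ] q - n ⊗ₜ[ℤ] (a • q) ∈ balancedRel S N M :=
      Submodule.subset_span ⟨n, a, q, rfl⟩
    have h₂ : (op b • n') ⊗ₜ[ℤ] q - n' ⊗ₜ[ℤ] (b • q) ∈ balancedRel S N M :=
      Submodule.subset_span ⟨n', b, q, rfl⟩
    have h₃ := sub_mem (add_mem h h') (add_mem h₁ h₂)
    convert h₃ using 1
    rw [TensorProduct.add_tmul]
    abel

end Flat

/-- A locally cyclic module that solves `d p = 0` by `p = b p'` with `d b = 0` is flat. -/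
theorem isFlat_of_exists {M : Type v} [AddCommGroup M] [Module S M]
    (hdir : ∀ x y : M, ∃ (p : M) (a b : S), x = a • p ∧ y = b • p)
    (hann : ∀ (d : S) (p : M), d • p = 0 → ∃ (b : S) (p' : M), p = b • p' ∧ d * b = 0) :
    IsFlat S M := by
  intro N N' _ _ _ _ φ hφ
  refine (injective_iff_map_eq_zero _).2 fun t ht => ?_
  obtain ⟨t, rfl⟩ := Submodule.mkQ_surjective _ t
  obtain ⟨n, p, hnp⟩ := exists_tmul_sub_mem_balancedRel hdir t
  have hmk : (balancedRel S N M).mkQ t = (balancedRel S N M).mkQ (n ⊗ₜ[ℤ] p) :=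
    (Submodule.Quotient.eq _).2 hnp
  rw [hmk] at ht ⊢
  have h1 : φ n ⊗ₜ[ℤ] p ∈ balancedRel S N' M := (Submodule.Quotient.mk_eq_zero _).1 ht
  obtain ⟨b, p', rfl, hb⟩ := exists_of_tmul_mem_balancedRel hdir hann h1
  rw [← map_smul] at hb
  have hb' : op b • n = 0 := (injective_iff_map_eq_zero φ).1 hφ _ hb
  refine (Submodule.Quotient.mk_eq_zero _).2 ?_
  have h2 : (op b • n) ⊗ₜ[ℤ] p' - n ⊗ₜ[ℤ] (b • p') ∈ balancedRel S N M :=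
    Submodule.subset_span ⟨n, b, p', rfl⟩
  rw [hb', TensorProduct.zero_tmul, zero_sub] at h2
  exact neg_mem_iff.1 h2

end Criteria

/-! ### A criterion for absolute purity -/

section AbsolutelyPure

variable {S : Type u} [Ring S]

/-- Morphisms from finitely generated submodules of `F` to `M` extend to `F`. -/
def ExtendsFrom (S : Type u) [Ring S] (M : Type v) [AddCommGroup M] [Module S M]
    (F : Type w) [AddCommGroup F] [Module S F] : Prop :=
  ∀ A : Submodule S F, A.FG → ∀ φ : A →ₗ[S] M, ∃ ψ : F →ₗ[S] M, ψ ∘ₗ A.subtype = φ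

theorem ExtendsFrom.of_equiv {M : Type v} [AddCommGroup M] [Module S M]
    {F : Type w} [AddCommGroup F] [Module S F] {F' : Type w} [AddCommGroup F'] [Module S F']
    (h : ExtendsFrom S M F) (e : F ≃ₗ[S] F') : ExtendsFrom S M F' := by
  intro A hA φ
  let ε := e.symm.submoduleMap A
  obtain ⟨ψ, hψ⟩ := h (A.map e.symm.toLinearMap) (hA.map _) (φ ∘ₗ ε.symm.toLinearMap)
  refine ⟨ψ ∘ₗ e.symm.toLinearMap, ?_⟩
  ext a
  refine (LinearMap.congr_fun hψ (ε a)).trans ?_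
  change φ (ε.symm (ε a)) = φ a
  rw [ε.symm_apply_apply]

theorem exists_eq_span_singleton_of_fg
    (hgen : ∀ x y : S, ∃ d, (∃ p, x = p * d) ∧ (∃ q, y = q * d) ∧ ∃ p q, d = p * x + q * y)
    {L : Ideal S} (hL : L.FG) : ∃ d, L = Ideal.span {d} := by
  refine Submodule.fg_induction (motive := fun L _ => ∃ d, L = Ideal.span {d})
    (fun x => ⟨x, rfl⟩) ?_ L hL
  rintro _ _ _ _ ⟨x, rfl⟩ ⟨y, rfl⟩
  obtain ⟨d, ⟨p, hp⟩, ⟨q, hq⟩, p', q', hd⟩ := hgen x y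
  refine ⟨d, le_antisymm (sup_le ?_ ?_) ?_⟩
  · exact (Ideal.span_singleton_le_iff_mem _).2 (Ideal.mem_span_singleton'.2 ⟨p, hp.symm⟩)
  · exact (Ideal.span_singleton_le_iff_mem _).2 (Ideal.mem_span_singleton'.2 ⟨q, hq.symm⟩)
  · refine (Ideal.span_singleton_le_iff_mem _).2 (hd ▸ add_mem ?_ ?_)
    · exact Ideal.mem_sup_left (Ideal.mul_mem_left _ _ (Ideal.subset_span rfl))
    · exact Ideal.mem_sup_right (Ideal.mul_mem_left _ _ (Ideal.subset_span rfl))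

/-- The first coordinates of A form S d. Choose a₀ in A over d. A ∩ F is finitely generated, since
the left annihilator of d is S e and e a₀ supplies the only extra generator. After extending over F,
it remains to send (1, 0) to some m' with d m' prescribed. -/
theorem ExtendsFrom.prod
    (hgen : ∀ x y : S, ∃ d, (∃ p, x = p * d) ∧ (∃ q, y = q * d) ∧ ∃ p q, d = p * x + q * y)
    {M : Type v} [AddCommGroup M] [Module S M]
    (hann : ∀ d : S, ∃ e, e * d = 0 ∧ (∀ t, t * d = 0 → ∃ y, t = y * e) ∧
      ∀ m : M, e • m = 0 → ∃ m', m = d • m')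
    {F : Type w} [AddCommGroup F] [Module S F] (h : ExtendsFrom S M F) :
    ExtendsFrom S M (S × F) := by
  intro A hA φ
  obtain ⟨d, hd⟩ := exists_eq_span_singleton_of_fg hgen (hA.map (LinearMap.fst S S F))
  obtain ⟨a₀, ha₀, ha₀d⟩ : d ∈ A.map (LinearMap.fst S S F) := hd ▸ Ideal.subset_span rfl
  obtain ⟨e, hed, he, heM⟩ := hann d
  have hdvd : ∀ a ∈ A, ∃ c, a.1 = c * d := fun a ha => by
    have : a.1 ∈ A.map (LinearMap.fst S S F) := ⟨a, ha, rfl⟩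
    rw [hd] at this
    obtain ⟨c, hc⟩ := Ideal.mem_span_singleton'.1 this
    exact ⟨c, hc.symm⟩
  have ha₀d' : a₀.1 = d := ha₀d
  have hea₀ : e • a₀ = (0, e • a₀.2) := Prod.ext (by simp [ha₀d', hed]) rfl
  let A' : Submodule S F := A.comap (LinearMap.inr S S F)
  have hdecomp : ∃ B : Submodule S F, B.FG ∧ B ≤ A' ∧
      ∀ a ∈ A, ∃ (l : S) (b : F), b ∈ B ∧ a = l • a₀ + (0, b) := by
    classical
    obtain ⟨T, rfl⟩ := hA
    choose! c hc using fun a (ha : a ∈ T) => hdvd a (Submodule.subset_span ha)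
    have hT : ∀ t ∈ T, t - c t • a₀ = (0, t.2 - c t • a₀.2) := fun t ht =>
      Prod.ext (by simp [ha₀d', hc t ht]) (by simp)
    refine ⟨Submodule.span S (T.image fun t => t.2 - c t • a₀.2), ⟨_, rfl⟩, ?_, ?_⟩
    · refine Submodule.span_le.2 ?_
      intro x hx
      obtain ⟨t, ht, rfl⟩ := Finset.mem_image.1 hx
      change (0, t.2 - c t • a₀.2) ∈ Submodule.span S (T : Set (S × F))
      rw [← hT t ht]
      exact sub_mem (Submodule.subset_span ht) (Submodule.smul_mem _ _ ha₀)
    · intro a ha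
      induction ha using Submodule.span_induction with
      | mem t ht =>
        refine ⟨c t, t.2 - c t • a₀.2, Submodule.subset_span
          (Finset.mem_image_of_mem _ ht), ?_⟩
        rw [← hT t ht, add_sub_cancel]
      | zero =>
        refine ⟨0, 0, zero_mem _, ?_⟩
        rw [zero_smul, zero_add]
        rfl
      | add x y _ _ hx hy =>
        obtain ⟨l, b, hb, rfl⟩ := hx
        obtain ⟨l', b', hb', rfl⟩ := hy
        refine ⟨l + l', b + b', add_mem hb hb', ?_⟩
        rw [add_smul, show ((0, b + b') : S × F) = (0, b) + (0, b') by simp]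
        abel
      | smul r x _ hx =>
        obtain ⟨l, b, hb, rfl⟩ := hx
        exact ⟨r * l, r • b, Submodule.smul_mem _ _ hb, by simp [mul_smul]⟩
  obtain ⟨B, hBfg, hBA, hB⟩ := hdecomp
  have hA' : A'.FG := by
    have : A' = B ⊔ Submodule.span S {e • a₀.2} := by
      refine le_antisymm (fun x hx => ?_) (sup_le hBA ?_)
      · obtain ⟨l, b, hb, hx'⟩ := hB _ hx
        have h1 : l * d = 0 := by simpa [ha₀d'] using (congrArg Prod.fst hx').symm
        obtain ⟨y, rfl⟩ := he l h1
        have h2 : x = y • e • a₀.2 + b := by simpa [mul_smul] using congrArg Prod.snd hx'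
        rw [h2]
        exact add_mem (Submodule.mem_sup_right (Submodule.smul_mem _ _
          (Submodule.subset_span rfl))) (Submodule.mem_sup_left hb)
      · refine (Submodule.span_singleton_le_iff_mem _ _).2 ?_
        change (0, e • a₀.2) ∈ A
        exact hea₀ ▸ A.smul_mem e ha₀
    rw [this]
    exact hBfg.sup (Submodule.fg_span_singleton _)
  obtain ⟨ψ, hψ⟩ := h A' hA' (φ ∘ₗ (LinearMap.inr S S F).restrict (p := A') (q := A) fun _ hx => hx)
  have hψ' : ∀ (b : F) (hb : (0, b) ∈ A), ψ b = φ ⟨(0, b), hb⟩ := fun b hb =>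
    LinearMap.congr_fun hψ ⟨b, hb⟩
  -- The prescribed value is killed by e, because e a₀ lies in A ∩ F, where ψ agrees with φ; so it
  -- is divisible by d.
  obtain ⟨m', hm'⟩ := heM (φ ⟨a₀, ha₀⟩ - ψ a₀.2) (by
    rw [smul_sub, ← map_smul, ← map_smul, hψ' _ (hea₀ ▸ A.smul_mem e ha₀), sub_eq_zero]
    congr 1
    exact Subtype.ext hea₀)
  refine ⟨(LinearMap.toSpanSingleton S M m').coprod ψ, ?_⟩
  ext ⟨a, ha⟩
  obtain ⟨l, b, hb, rfl⟩ := hB a ha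
  have hbA : (0, b) ∈ A := hBA hb
  have h1 : φ ⟨l • a₀ + (0, b), ha⟩ = l • φ ⟨a₀, ha₀⟩ + φ ⟨(0, b), hbA⟩ := by
    rw [← map_smul, ← map_add]
    rfl
  rw [h1, ← hψ' b hbA, eq_add_of_sub_eq hm']
  simp [ha₀d', mul_smul, add_assoc]

theorem extendsFrom_pi
    (hgen : ∀ x y : S, ∃ d, (∃ p, x = p * d) ∧ (∃ q, y = q * d) ∧ ∃ p q, d = p * x + q * y)
    {M : Type v} [AddCommGroup M] [Module S M]
    (hann : ∀ d : S, ∃ e, e * d = 0 ∧ (∀ t, t * d = 0 → ∃ y, t = y * e) ∧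
      ∀ m : M, e • m = 0 → ∃ m', m = d • m') (n : ℕ) :
    ExtendsFrom S M (Fin n → S) := by
  induction n with
  | zero =>
    intro A _ φ
    refine ⟨0, ?_⟩
    ext a
    rw [Subsingleton.elim a 0]
    simp
  | succ n ih =>
    exact (ih.prod hgen hann).of_equiv (Fin.consLinearEquiv S (fun _ : Fin (n + 1) => S))

-- For a presentation 0 → A → Sⁿ → G → 0 with A finitely generated, every class in Ext¹(G, M) is the
-- pushout of the extension along a map A → M. That map extends to Sⁿ, so the class vanishes.
open CategoryTheory in
theorem isAbsolutelyPure_of_extendsFrom {M : Type u} [AddCommGroup M] [Module S M]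
    (h : ∀ n : ℕ, ExtendsFrom S M (Fin n → S)) : IsAbsolutelyPure S M := by
  intro G _ _ hG
  have : HasExt.{u} (ModuleCat.{u} S) := hasExt_of_enoughProjectives (ModuleCat.{u} S)
  obtain ⟨n, A, e, hA⟩ := Module.FinitePresentation.exists_fin S G
  let T : ShortComplex (ModuleCat.{u} S) :=
    ShortComplex.mk (ModuleCat.ofHom A.subtype)
      (ModuleCat.ofHom (e.symm.toLinearMap ∘ₗ A.mkQ)) (by
        ext a
        simp)
  have hT : T.ShortExact := by
    refine ModuleCat.shortComplex_shortExact T ?_ ?_ ?_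
    · intro x
      change e.symm (A.mkQ x) = 0 ↔ ∃ y, A.subtype y = x
      simp
    · exact A.subtype_injective
    · exact e.symm.surjective.comp A.mkQ_surjective
  have hP : Projective T.X₂ := inferInstanceAs (Projective (ModuleCat.of S (Fin n → S)))
  refine ⟨fun x y => ?_⟩
  have key : ∀ x : Abelian.Ext T.X₃ (ModuleCat.of S M) 1, x = 0 := by
    intro x
    obtain ⟨x₁, rfl⟩ := Abelian.Ext.contravariant_sequence_exact₃ hT (ModuleCat.of S M) x
      (Abelian.Ext.eq_zero_of_projective _) (n₀ := 0) rfl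
    obtain ⟨φ, rfl⟩ := Abelian.Ext.addEquiv₀.symm.surjective x₁
    obtain ⟨ψ, hψ⟩ := h n A hA φ.hom
    have hφ : φ = T.f ≫ ModuleCat.ofHom ψ := by
      ext a
      exact (LinearMap.congr_fun hψ a).symm
    have hcomp := Abelian.Ext.mk₀_comp_mk₀ T.f (ModuleCat.ofHom ψ)
    rw [← hφ] at hcomp
    change hT.extClass.comp (Abelian.Ext.mk₀ φ) _ = 0
    rw [← hcomp]
    exact hT.extClass_comp_assoc _
  exact (key x).trans (key y).symm

end AbsolutelyPure

/-! ### The quotient of a pure left ideal by Ig -/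

section PureIdeal

variable {S : Type u} [Ring S]

/-- Purity is tested on S/Sb: the map 1 ↦ x + L lifts to some y in I with b y = 0 and y - x ∈ L, and
x - y is the solution. -/
theorem IsPure.exists_mul_eq {I L : Ideal S} (h : IsPure (L.submoduleOf I)) {b x : S}
    (hx : x ∈ I) (hbx : b * x ∈ L) : ∃ y ∈ L, b * y = b * x := by
  have hG : Module.FinitePresentation S (S ⧸ Ideal.span {b}) :=
    Module.finitePresentation_of_surjective (Ideal.span {b}).mkQ (Submodule.mkQ_surjective _) (by
      rw [Submodule.ker_mkQ]
      exact Submodule.fg_span_singleton b)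
  let φ : S →ₗ[S] I ⧸ L.submoduleOf I :=
    LinearMap.toSpanSingleton S _ ((L.submoduleOf I).mkQ ⟨x, hx⟩)
  have hφ : Ideal.span {b} ≤ LinearMap.ker φ := by
    rw [Ideal.span_singleton_le_iff_mem, LinearMap.mem_ker, LinearMap.toSpanSingleton_apply,
      ← map_smul, Submodule.mkQ_apply, Submodule.Quotient.mk_eq_zero]
    exact hbx
  obtain ⟨k, hk⟩ := h _ hG ((Ideal.span {b}).liftQ φ hφ)
  obtain ⟨q, hq⟩ : ∃ q, q = (Ideal.span {b}).mkQ (1 : S) := ⟨_, rfl⟩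
  have hbq : b • q = 0 := by
    rw [hq, ← map_smul, smul_eq_mul, mul_one, Submodule.mkQ_apply, Submodule.Quotient.mk_eq_zero]
    exact Ideal.subset_span rfl
  obtain ⟨y, hky⟩ : ∃ y, y = k q := ⟨_, rfl⟩
  have hy : (y : S) - x ∈ L := by
    have h1 : (L.submoduleOf I).mkQ y = (L.submoduleOf I).mkQ ⟨x, hx⟩ := by
      rw [hky]
      refine (LinearMap.congr_fun hk q).trans ?_
      rw [hq, Submodule.mkQ_apply, Submodule.liftQ_apply]
      exact one_smul _ _
    have h2 : y - ⟨x, hx⟩ ∈ L.submoduleOf I := (Submodule.Quotient.eq _).1 h1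
    exact h2
  have hby : b * (y : S) = 0 := by
    have h1 : b • y = 0 := by rw [hky, ← map_smul, hbq, map_zero]
    exact congrArg Subtype.val h1
  refine ⟨x - y, by simpa using L.neg_mem hy, ?_⟩
  rw [mul_sub, hby, sub_zero]

/-- A left ideal `L ≤ I` that is closed under solving equations `b y = c` solvable in `I`, together
with an epimorphism `g` in `L`. -/
structure IsPureIn (I K L : Ideal S) (g : S) : Prop where
  le : L ≤ I
  mem : g ∈ L
  notMem : g ∉ K
  pure : ∀ b x, x ∈ I → b * x ∈ L → ∃ y ∈ L, b * y = b * x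

/-- The module `L / I g`. -/
abbrev QuotMul (I L : Ideal S) (g : S) : Type u :=
  L ⧸ (Submodule.map (rightMul g) I).submoduleOf L

namespace QuotMul

variable {I K L : Ideal S} {g : S}

/-- The class of `t` in `L / I g`. -/
def mk (I : Ideal S) {L : Ideal S} (g : S) {t : S} (ht : t ∈ L) : QuotMul I L g :=
  Submodule.Quotient.mk ⟨t, ht⟩

theorem exists_mk (x : QuotMul I L g) : ∃ (t : S) (ht : t ∈ L), x = mk I g ht := by
  obtain ⟨⟨t, ht⟩, rfl⟩ := Submodule.mkQ_surjective _ x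
  exact ⟨t, ht, rfl⟩

theorem smul_mk (s : S) {t : S} (ht : t ∈ L) :
    s • mk I g ht = mk I g (L.mul_mem_left s ht) :=
  rfl

theorem mk_eq_mk {s t : S} (hs : s ∈ L) (ht : t ∈ L) :
    mk I g hs = mk I g ht ↔ ∃ z ∈ I, s - t = z * g := by
  refine (Submodule.Quotient.eq _).trans ?_
  constructor
  · rintro ⟨z, hz, h⟩
    exact ⟨z, hz, h.symm⟩
  · rintro ⟨z, hz, h⟩
    exact ⟨z, hz, h.symm⟩

theorem mk_eq_zero {t : S} (ht : t ∈ L) : mk I g ht = 0 ↔ ∃ z ∈ I, t = z * g := by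
  refine (mk_eq_mk ht L.zero_mem).trans ?_
  rw [sub_zero]

theorem exists_smul_eq (h : IsDPPair I K) (hL : IsPureIn I K L g) {d : S} (hd : d ∉ K)
    (m : QuotMul I L g) : ∃ m', m = d • m' := by
  obtain ⟨t, ht, rfl⟩ := exists_mk m
  obtain ⟨v, hv, rfl⟩ := h.exists_eq_mul_mem_I hd (hL.le ht)
  obtain ⟨y, hy, hdy⟩ := hL.pure d v hv ht
  refine ⟨mk I g hy, ?_⟩
  rw [smul_mk, mk_eq_mk]
  exact ⟨0, zero_mem _, by rw [hdy]; simp⟩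

/-- If e t = z g with z = e y and y ∈ I, then e kills t - y g, which is therefore f x; purity moves
x into L, and y g vanishes in the quotient. -/
theorem exists_smul_eq_of_exactPair (h : IsDPPair I K) (hL : IsPureIn I K L g) {f e : S}
    (hf : f ∉ I) (he : e ∉ K) (hfe : ExactPair f e) (m : QuotMul I L g) (hm : e • m = 0) :
    ∃ m', m = f • m' := by
  obtain ⟨t, ht, rfl⟩ := exists_mk m
  rw [smul_mk, mk_eq_zero] at hm
  obtain ⟨z, hz, hz'⟩ := hm
  obtain ⟨y, hy, rfl⟩ := h.exists_eq_mul_mem_I he hz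
  obtain ⟨x, hx⟩ := hfe.eq_mul_of_mul_eq_zero' (t - y * g)
    (by rw [mul_sub, hz', mul_assoc, sub_self])
  have hL' : t - y * g ∈ L := L.sub_mem ht (L.mul_mem_left _ hL.mem)
  have hxI : x ∈ I := h.mem_I_of_mul_mem hf (hx ▸ hL.le hL')
  obtain ⟨x', hx', hfx⟩ := hL.pure f x hxI (hx ▸ hL')
  refine ⟨mk I g hx', ?_⟩
  rw [smul_mk, mk_eq_mk]
  exact ⟨y, hy, by rw [hfx, ← hx, sub_sub_cancel]⟩

theorem exists_annihilator (h : IsDPPair I K) (hL : IsPureIn I K L g) (d : S) :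
    ∃ e, e * d = 0 ∧ (∀ t, t * d = 0 → ∃ y, t = y * e) ∧
      ∀ m : QuotMul I L g, e • m = 0 → ∃ m', m = d • m' := by
  by_cases hd0 : d = 0
  · refine ⟨1, by simp [hd0], fun t _ => ⟨t, by simp⟩, fun m hm => ⟨0, ?_⟩⟩
    rw [smul_zero, ← hm, one_smul]
  obtain ⟨f, k, hf, hk, rfl⟩ := h.factor d hd0
  have hlann : ∀ t, t * (f * k) = 0 → t * f = 0 := fun t ht =>
    h.cancel_K k _ hk (by rw [mul_assoc, ht])
  by_cases hfK : f ∈ K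
  · obtain ⟨e, heI, he, hfe⟩ := h.exists_right f hfK hf
    refine ⟨e, by rw [← mul_assoc, hfe.mul_eq_zero, zero_mul],
      fun t ht => hfe.eq_mul_of_mul_eq_zero t (hlann t ht), fun m hm => ?_⟩
    obtain ⟨m', rfl⟩ := exists_smul_eq_of_exactPair h hL hf he hfe m hm
    obtain ⟨m'', rfl⟩ := exists_smul_eq h hL hk m'
    exact ⟨m'', (mul_smul _ _ _).symm⟩
  · refine ⟨0, zero_mul _, fun t ht => ⟨0, ?_⟩, fun m _ =>
      exists_smul_eq h hL (h.prime_K _ _ hfK hk) m⟩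
    rw [mul_zero, h.cancel_K f t hfK (hlann t ht)]

/-- With d = f k, the mono f cancels from f k t = z g, since z is a multiple of f. What is left is k
t = z' g with z' ∈ I, and the kernel of the epi k supplies b. -/
theorem exists_eq_smul_of_smul_eq_zero (h : IsDPPair I K) (hL : IsPureIn I K L g) (d : S)
    (p : QuotMul I L g) (hp : d • p = 0) :
    ∃ (b : S) (p' : QuotMul I L g), p = b • p' ∧ d * b = 0 := by
  by_cases hd0 : d = 0
  · exact ⟨1, p, by simp [hd0]⟩
  obtain ⟨f, k, hf, hk, rfl⟩ := h.factor d hd0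
  obtain ⟨t, ht, rfl⟩ := exists_mk p
  rw [smul_mk, mk_eq_zero] at hp
  obtain ⟨z, hz, hz'⟩ := hp
  have hkt : ∃ z' ∈ I, k * t = z' * g := by
    have : ∃ z', z = f * z' := by
      by_cases hfK : f ∈ K
      · obtain ⟨e, -, he, hfe⟩ := h.exists_right f hfK hf
        refine hfe.eq_mul_of_mul_eq_zero' z (h.cancel_K g _ hL.notMem ?_)
        rw [mul_assoc, ← hz', ← mul_assoc, ← mul_assoc, hfe.mul_eq_zero, zero_mul, zero_mul]
      · obtain ⟨f, rfl⟩ := h.isUnit f hf hfK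
        exact ⟨↑f⁻¹ * z, by simp⟩
    obtain ⟨z', rfl⟩ := this
    refine ⟨z', h.mem_I_of_mul_mem hf hz, h.mul_left_cancel hf ?_⟩
    rw [← mul_assoc, hz', mul_assoc]
  obtain ⟨z', hz'I, hkt⟩ := hkt
  by_cases hkI : k ∈ I
  · obtain ⟨b, -, hb, hbk⟩ := h.exists_left k hkI hk
    obtain ⟨y, hy, rfl⟩ := h.exists_eq_mul_mem_I hk hz'I
    obtain ⟨x, hx⟩ := hbk.eq_mul_of_mul_eq_zero' (t - y * g)
      (by rw [mul_sub, hkt, mul_assoc, sub_self])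
    have hL' : t - y * g ∈ L := L.sub_mem ht (L.mul_mem_left _ hL.mem)
    obtain ⟨x', hx', hbx⟩ := hL.pure b x (h.mem_I_of_mul_mem hb (hx ▸ hL.le hL')) (hx ▸ hL')
    refine ⟨b, mk I g hx', ?_, by rw [mul_assoc, hbk.mul_eq_zero, mul_zero]⟩
    rw [smul_mk, mk_eq_mk]
    exact ⟨y, hy, by rw [hbx, ← hx, sub_sub_cancel]⟩
  · obtain ⟨k, rfl⟩ := h.isUnit k hkI hk
    refine ⟨0, 0, ?_, by simp⟩
    rw [smul_zero, mk_eq_zero]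
    exact ⟨↑k⁻¹ * z', I.mul_mem_left _ hz'I, by rw [mul_assoc, ← hkt, Units.inv_mul_cancel_left]⟩

theorem comparable (h : IsDPPair I K) (hL : IsPureIn I K L g) (x y : QuotMul I L g) :
    (∃ a : S, x = a • y) ∨ ∃ a : S, y = a • x := by
  obtain ⟨s, hs, rfl⟩ := exists_mk x
  obtain ⟨t, ht, rfl⟩ := exists_mk y
  refine (h.comparable_mod hL.notMem (hL.le hs) (hL.le ht)).imp ?_ ?_
  · rintro ⟨a, ha⟩
    exact ⟨a, by rwa [smul_mk, mk_eq_mk]⟩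
  · rintro ⟨a, ha⟩
    exact ⟨a, by rwa [smul_mk, mk_eq_mk]⟩

theorem isUniserial (h : IsDPPair I K) (hL : IsPureIn I K L g) :
    IsUniserial S (QuotMul I L g) :=
  isUniserial_of_comparable (comparable h hL)

theorem isFlat (h : IsDPPair I K) (hL : IsPureIn I K L g) : IsFlat S (QuotMul I L g) := by
  refine isFlat_of_exists (fun x y => ?_) (exists_eq_smul_of_smul_eq_zero h hL)
  rcases comparable h hL x y with ⟨a, ha⟩ | ⟨a, ha⟩
  · exact ⟨y, a, 1, ha, by simp⟩
  · exact ⟨x, 1, a, by simp, ha⟩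

theorem isAbsolutelyPure (h : IsDPPair I K) (hL : IsPureIn I K L g) :
    IsAbsolutelyPure S (QuotMul I L g) :=
  isAbsolutelyPure_of_extendsFrom
    (extendsFrom_pi h.exists_generator (exists_annihilator h hL))

theorem pushoutMap_mk (hL : g ∈ L) (x : S) :
    pushoutMap I L g hL (Submodule.Quotient.mk x) = mk I g (L.mul_mem_left x hL) :=
  rfl

theorem pushoutMap_injective (h : IsDPPair I K) (hL : IsPureIn I K L g) :
    Function.Injective (pushoutMap I L g hL.mem) := by
  refine (injective_iff_map_eq_zero _).2 fun x hx => ?_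
  obtain ⟨x, rfl⟩ := Submodule.mkQ_surjective _ x
  rw [Submodule.mkQ_apply, pushoutMap_mk, mk_eq_zero] at hx
  obtain ⟨z, hz, hxz⟩ := hx
  exact (Submodule.Quotient.mk_eq_zero _).2 (h.mul_right_cancel hL.notMem hxz ▸ hz)

end QuotMul

theorem IsDPPair.isCoatom {I K : Ideal S} (h : IsDPPair I K) : IsCoatom I := by
  refine ⟨fun h1 => h.one_notMem_I (h1 ▸ Submodule.mem_top), fun A hA => ?_⟩
  obtain ⟨s, hs, hsI⟩ := SetLike.exists_of_lt hA
  rw [Ideal.eq_top_iff_one]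
  by_cases hsK : s ∈ K
  · obtain ⟨g, hg, hgK⟩ := h.exists_epi
    exact (Ideal.eq_top_iff_one _).1
      (Ideal.eq_top_of_isUnit_mem A (A.add_mem hs (hA.le hg)) (h.isUnit_add hsK hsI hg hgK))
  · exact (Ideal.eq_top_iff_one _).1 (Ideal.eq_top_of_isUnit_mem A hs (h.isUnit s hsI hsK))

theorem IsDPPair.isSimpleModule {I K : Ideal S} (h : IsDPPair I K) : IsSimpleModule S (S ⧸ I) :=
  isSimpleModule_iff_isCoatom.2 h.isCoatom

theorem range_eq_socle {A M : Type v} [AddCommGroup A] [Module S A] [AddCommGroup M]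
    [Module S M] (hA : IsSimpleModule S A) (hM : IsUniserial S M) {φ : A →ₗ[S] M}
    (hφ : Function.Injective φ) : LinearMap.range φ = socle S M := by
  have hr : IsSimpleModule S (LinearMap.range φ) :=
    IsSimpleModule.congr (LinearEquiv.ofInjective φ hφ).symm
  refine le_antisymm (le_sSup hr) (sSup_le fun N hN => ?_)
  rcases hM N (LinearMap.range φ) with h | h
  · exact h
  · have hN' := isSimpleModule_iff_isAtom.1 hN
    have hr' := isSimpleModule_iff_isAtom.1 hr
    exact (((hN'.le_iff).1 h).resolve_left hr'.1).ge

end PureIdeal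

/-! ### Left almost split morphisms from S/I -/

section AlmostSplit

variable {S : Type u} [Ring S] {I K L : Ideal S} {g : S}

theorem IsDPPair.isSemisimpleModule (h : IsDPPair I K) {Q : Type v} [AddCommGroup Q] [Module S Q]
    (hQ : ∀ i ∈ I, ∀ x : Q, i • x = 0) : IsSemisimpleModule S Q := by
  refine IsSemisimpleModule.of_sSup_simples_eq_top (eq_top_iff.2 fun x _ => ?_)
  by_cases hx : x = 0
  · rw [hx]
    exact zero_mem _
  have := h.isSimpleModule
  let φ : (S ⧸ I) →ₗ[S] Q := I.liftQ (LinearMap.toSpanSingleton S Q x) fun i hi => hQ i hi x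
  have hφ1 : φ (Submodule.Quotient.mk 1) = x := one_smul S x
  have hφ : Function.Injective φ := by
    refine φ.injective_or_eq_zero.resolve_right fun h0 => hx ?_
    rw [← hφ1, h0]
    rfl
  have hs : IsSimpleModule S (LinearMap.range φ) :=
    IsSimpleModule.congr (LinearEquiv.ofInjective φ hφ).symm
  exact le_sSup (a := LinearMap.range φ) hs ⟨_, hφ1⟩

/-- The submodule `g N`, which equals `I N`. -/
def mulSubmodule (h : IsDPPair I K) (hg : g ∈ I) (hgK : g ∉ K) (N : Type v) [AddCommGroup N]
    [Module S N] : Submodule S N where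
  carrier := {n | ∃ n', n = g • n'}
  zero_mem' := ⟨0, by simp⟩
  add_mem' := by
    rintro _ _ ⟨x, rfl⟩ ⟨y, rfl⟩
    exact ⟨x + y, by simp⟩
  smul_mem' := by
    rintro s _ ⟨x, rfl⟩
    obtain ⟨v, hv⟩ := h.eq_mul_of_mem_I g hgK (s * g) (I.mul_mem_left _ hg)
    exact ⟨v • x, by rw [smul_smul, smul_smul, hv]⟩

theorem smul_mem_mulSubmodule (h : IsDPPair I K) (hg : g ∈ I) (hgK : g ∉ K) {N : Type v}
    [AddCommGroup N] [Module S N] {i : S} (hi : i ∈ I) (n : N) :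
    i • n ∈ mulSubmodule h hg hgK N := by
  obtain ⟨v, rfl⟩ := h.eq_mul_of_mem_I g hgK i hi
  exact ⟨v • n, mul_smul _ _ _⟩

/-- N/IN is semisimple because I kills it. If q(1) were outside IN, the simple module S/I would
embed in N/IN as a direct summand, and q would split. -/
theorem mem_mulSubmodule_of_not_isSplitMono (h : IsDPPair I K) (hg : g ∈ I) (hgK : g ∉ K)
    {N : Type u} [AddCommGroup N] [Module S N] {q : (S ⧸ I) →ₗ[S] N} (hq : ¬ IsSplitMono q) :
    q (Submodule.Quotient.mk 1) ∈ mulSubmodule h hg hgK N := by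
  by_contra hn
  have := h.isSimpleModule
  have hss : IsSemisimpleModule S (N ⧸ mulSubmodule h hg hgK N) := by
    refine h.isSemisimpleModule fun i hi x => ?_
    obtain ⟨x, rfl⟩ := Submodule.mkQ_surjective _ x
    rw [← map_smul]
    exact (Submodule.Quotient.mk_eq_zero _).2 (smul_mem_mulSubmodule h hg hgK hi x)
  have hinj : Function.Injective ((mulSubmodule h hg hgK N).mkQ ∘ₗ q) := by
    refine (LinearMap.injective_or_eq_zero _).resolve_right fun h0 => hn ?_
    exact (Submodule.Quotient.mk_eq_zero _).1 (LinearMap.congr_fun h0 (Submodule.Quotient.mk 1))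
  obtain ⟨r, hr⟩ := IsSemisimpleModule.extension_property _ hinj LinearMap.id
  exact hq ⟨r ∘ₗ (mulSubmodule h hg hgK N).mkQ, hr⟩

theorem exists_smul_eq_mem_mulSubmodule (h : IsDPPair I K) (hg : g ∈ I) (hgK : g ∉ K)
    {N : Type v} [AddCommGroup N] [Module S N] {x : S} (hx : x ∉ K) {n : N}
    (hn : n ∈ mulSubmodule h hg hgK N) : ∃ n' ∈ mulSubmodule h hg hgK N, n = x • n' := by
  obtain ⟨m, rfl⟩ := hn
  obtain ⟨v, hv, rfl⟩ := h.exists_eq_mul_mem_I hx hg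
  exact ⟨v • m, smul_mem_mulSubmodule h hg hgK hv m, mul_smul _ _ _⟩

theorem exists_chain_of_countable (h : IsDPPair I K) (hL : IsPureIn I K L g)
    (hc : ∃ s : Set S, s.Countable ∧ Ideal.span s = L) :
    ∃ t x : ℕ → S, t 0 = g ∧ (∀ k, t k ∈ L) ∧ (∀ k, t k ∉ K) ∧ (∀ k, t k = x k * t (k + 1)) ∧
      ∀ s ∈ L, ∃ k y, s = y * t k := by
  obtain ⟨s, hs, hsL⟩ := hc
  obtain ⟨σ, hσ⟩ := (hs.insert g).exists_eq_range (Set.insert_nonempty _ _)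
  have hσL : ∀ n, σ n ∈ L := fun n => by
    have : σ n ∈ insert g s := hσ ▸ ⟨n, rfl⟩
    rcases this with h' | h'
    · exact h' ▸ hL.mem
    · exact hsL ▸ Ideal.subset_span h'
  -- Writing s = f k, purity solves f y = f k inside L, and cancelling the mono f puts the epi k
  -- into L.
  have epi : ∀ s ∈ L, ∃ t ∈ L, t ∉ K ∧ ∃ y, s = y * t := by
    intro s hs
    by_cases hs0 : s = 0
    · exact ⟨g, hL.mem, hL.notMem, 0, by simp [hs0]⟩
    obtain ⟨f, k, hf, hk, rfl⟩ := h.factor s hs0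
    obtain ⟨y, hy, hfy⟩ := hL.pure f k (h.mem_I_of_mul_mem hf (hL.le hs)) hs
    exact ⟨k, h.mul_left_cancel hf hfy ▸ hy, hk, f, rfl⟩
  have step : ∀ (n : ℕ) (t : {t // t ∈ L ∧ t ∉ K}), ∃ t' : {t // t ∈ L ∧ t ∉ K},
      (∃ x, t.1 = x * t'.1) ∧ ∃ y, σ n = y * t'.1 := by
    rintro n ⟨t, ht, htK⟩
    obtain ⟨r, hr, hrK, y, hy⟩ := epi _ (hσL n)
    rcases h.comparable t r htK hrK with ⟨z, hz⟩ | ⟨z, hz⟩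
    · exact ⟨⟨r, hr, hrK⟩, ⟨z, hz⟩, y, hy⟩
    · exact ⟨⟨t, ht, htK⟩, ⟨1, by simp⟩, y * z, by rw [hy, hz, mul_assoc]⟩
  choose next hnext₁ hnext₂ using step
  let t : ℕ → {t // t ∈ L ∧ t ∉ K} := fun n => Nat.rec ⟨g, hL.mem, hL.notMem⟩ next n
  choose x hx using fun n => hnext₁ n (t n)
  have mono : ∀ n m, ∃ y, (t n).1 = y * (t (n + m)).1 := by
    intro n m
    induction m with
    | zero => exact ⟨1, by simp⟩
    | succ m ih =>
      obtain ⟨y, hy⟩ := ih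
      exact ⟨y * x (n + m), by rw [hy, mul_assoc]; exact congrArg _ (hx (n + m))⟩
  refine ⟨fun n => (t n).1, x, rfl, fun k => (t k).2.1, fun k => (t k).2.2, hx, fun s' hs' => ?_⟩
  rw [← hsL] at hs'
  induction hs' using Submodule.span_induction with
  | mem a ha =>
    have : a ∈ insert g s := Set.mem_insert_of_mem _ ha
    rw [hσ] at this
    obtain ⟨n, rfl⟩ := this
    obtain ⟨y, hy⟩ := hnext₂ n (t n)
    exact ⟨n + 1, y, hy⟩
  | zero => exact ⟨0, 0, by simp⟩
  | add a b _ _ ha hb =>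
    obtain ⟨n, y, rfl⟩ := ha
    obtain ⟨m, z, rfl⟩ := hb
    obtain ⟨c, hc⟩ := mono n m
    obtain ⟨d, hd⟩ := mono m n
    rw [add_comm m n] at hd
    exact ⟨n + m, y * c + z * d, by simp only [hc, hd]; noncomm_ring⟩
  | smul r a _ ha =>
    obtain ⟨n, y, rfl⟩ := ha
    exact ⟨n, r * y, by rw [smul_eq_mul, mul_assoc]⟩

/-- A compatible sequence of elements defines a morphism on the union of a chain of free cyclic
left ideals. -/
theorem exists_linearMap_of_chain {t x : ℕ → S} (ht : ∀ k, t k ∈ L)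
    (hcancel : ∀ k y y', y * t k = y' * t k → y = y') (hx : ∀ k, t k = x k * t (k + 1))
    (hL : ∀ s ∈ L, ∃ k y, s = y * t k) {N : Type v} [AddCommGroup N] [Module S N] (n : ℕ → N)
    (hn : ∀ k, n k = x k • n (k + 1)) : ∃ φ : L →ₗ[S] N, ∀ k, φ ⟨t k, ht k⟩ = n k := by
  have mono : ∀ k m, ∃ y, t k = y * t (k + m) ∧ n k = y • n (k + m) := by
    intro k m
    induction m with
    | zero => exact ⟨1, by simp⟩
    | succ m ih =>
      obtain ⟨y, hy, hy'⟩ := ih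
      refine ⟨y * x (k + m), ?_, ?_⟩
      · rw [hy, mul_assoc]
        exact congrArg _ (hx (k + m))
      · rw [hy', mul_smul]
        exact congrArg _ (hn (k + m))
  choose κ c hc using hL
  let φ : L → N := fun s => c s.1 s.2 • n (κ s.1 s.2)
  have hφ : ∀ (s : L) k y, s.1 = y * t k → φ s = y • n k := by
    intro s k y hs
    obtain ⟨d, hd, hd'⟩ := mono k (κ s.1 s.2)
    obtain ⟨e, he, he'⟩ := mono (κ s.1 s.2) k
    rw [add_comm] at he he'
    change c s.1 s.2 • n (κ s.1 s.2) = _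
    rw [he', hd', smul_smul, smul_smul]
    congr 1
    apply hcancel (k + κ s.1 s.2)
    rw [mul_assoc, mul_assoc, ← hd, ← he, ← hs, ← hc]
  refine ⟨{ toFun := φ, map_add' := fun s s' => ?_, map_smul' := fun r s => ?_ }, fun k => ?_⟩
  · obtain ⟨d, hd, -⟩ := mono (κ s.1 s.2) (κ s'.1 s'.2)
    obtain ⟨e, he, -⟩ := mono (κ s'.1 s'.2) (κ s.1 s.2)
    rw [add_comm] at he
    have h₁ : s.1 = c s.1 s.2 * d * t (κ s.1 s.2 + κ s'.1 s'.2) := by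
      rw [mul_assoc, ← hd, ← hc]
    have h₂ : s'.1 = c s'.1 s'.2 * e * t (κ s.1 s.2 + κ s'.1 s'.2) := by
      rw [mul_assoc, ← he, ← hc]
    rw [hφ s _ _ h₁, hφ s' _ _ h₂, ← add_smul]
    exact hφ _ _ _ (by rw [add_mul, ← h₁, ← h₂]; rfl)
  · rw [RingHom.id_apply, hφ s _ _ (hc s.1 s.2), smul_smul]
    exact hφ _ _ _ (by rw [mul_assoc, ← hc]; rfl)
  · exact (hφ _ k 1 (one_mul _).symm).trans (one_smul _ _)

/-- Countability enters here: each element of gN is x_k times another element of gN, so the images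
of the t_k are chosen recursively. -/
theorem exists_linearMap_of_mem_mulSubmodule (h : IsDPPair I K) (hL : IsPureIn I K L g)
    (hc : ∃ s : Set S, s.Countable ∧ Ideal.span s = L) (hg : g ∈ I) (hgK : g ∉ K)
    {N : Type v} [AddCommGroup N] [Module S N] {n : N} (hn : n ∈ mulSubmodule h hg hgK N) :
    ∃ φ : L →ₗ[S] N, φ ⟨g, hL.mem⟩ = n := by
  obtain ⟨t, x, rfl, htL, htK, hx, hLt⟩ := exists_chain_of_countable h hL hc
  have hxK : ∀ k, x k ∉ K := fun k hk => htK k (hx k ▸ h.mul_mem_K _ hk _)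
  choose! next hnext hnext' using fun (k : ℕ) (m : N) (hm : m ∈ mulSubmodule h hg hgK N) =>
    exists_smul_eq_mem_mulSubmodule h hg hgK (hxK k) hm
  let ν : ℕ → N := fun k => Nat.rec n next k
  have hν : ∀ k, ν k ∈ mulSubmodule h hg hgK N := by
    intro k
    induction k with
    | zero => exact hn
    | succ k ih => exact hnext k _ ih
  obtain ⟨φ, hφ⟩ := exists_linearMap_of_chain htL
    (fun k y y' hy => h.mul_right_cancel (htK k) hy) hx hLt ν fun k => hnext' k _ (hν k)
  exact ⟨φ, hφ 0⟩

theorem exists_comp_pushoutMap_eq (h : IsDPPair I K) (hL : IsPureIn I K L g)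
    (hc : ∃ s : Set S, s.Countable ∧ Ideal.span s = L) (hg : g ∈ I) (hgK : g ∉ K)
    {N : Type v} [AddCommGroup N] [Module S N] {q : (S ⧸ I) →ₗ[S] N}
    (hn : q (Submodule.Quotient.mk 1) ∈ mulSubmodule h hg hgK N) :
    ∃ k : QuotMul I L g →ₗ[S] N, k ∘ₗ pushoutMap I L g hL.mem = q := by
  obtain ⟨φ, hφ⟩ := exists_linearMap_of_mem_mulSubmodule h hL hc hg hgK hn
  have hφz : ∀ z, φ (z • ⟨g, hL.mem⟩) = q (Submodule.Quotient.mk z) := by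
    intro z
    rw [map_smul, hφ, ← map_smul, ← Submodule.Quotient.mk_smul, smul_eq_mul, mul_one]
  refine ⟨Submodule.liftQ _ φ ?_, ?_⟩
  · rintro ⟨_, hsL⟩ ⟨z, hz, rfl⟩
    rw [LinearMap.mem_ker]
    refine (hφz z).trans ?_
    rw [(Submodule.Quotient.mk_eq_zero _).2 hz, map_zero]
  · ext
    change φ ((1 : S) • ⟨g, hL.mem⟩) = _
    rw [hφz]
    rfl

/-- The image of 1 is divisible by g in L/Ig; a retraction would make 1 divisible by g in S/I, which
g annihilates. -/
theorem not_isSplitMono_pushoutMap (h : IsDPPair I K) (hL : IsPureIn I K L g) :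
    ¬ IsSplitMono (pushoutMap I L g hL.mem) := by
  rintro ⟨r, hr⟩
  obtain ⟨m, hm⟩ := QuotMul.exists_smul_eq h hL hL.notMem
    (pushoutMap I L g hL.mem (Submodule.Quotient.mk 1))
  have h1 : (Submodule.Quotient.mk 1 : S ⧸ I) = g • r m := by
    rw [← map_smul, ← hm]
    exact (LinearMap.congr_fun hr _).symm
  obtain ⟨y, hy⟩ := Submodule.mkQ_surjective _ (r m)
  rw [← hy, ← map_smul] at h1
  have h2 : (1 : S) - g * y ∈ I := (Submodule.Quotient.eq _).1 h1
  refine h.one_notMem_I ?_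
  simpa using I.add_mem h2 (h.mul_mem_I g (hL.le hL.mem) y)

theorem isLeftAlmostSplit_pushoutMap (h : IsDPPair I K) (hL : IsPureIn I K L g)
    (hc : ∃ s : Set S, s.Countable ∧ Ideal.span s = L) :
    IsLeftAlmostSplit (pushoutMap I L g hL.mem) :=
  ⟨not_isSplitMono_pushoutMap h hL, fun _ _ _ _ hq =>
    exists_comp_pushoutMap_eq h hL hc (hL.le hL.mem) hL.notMem
      (mem_mulSubmodule_of_not_isSplitMono h _ _ hq)⟩

theorem not_injective_quotient (h : IsDPPair I K) (hL : IsPureIn I K L g) :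
    ¬ Module.Injective S (S ⧸ I) := by
  intro hinj
  obtain ⟨r, hr⟩ := hinj.out (pushoutMap I L g hL.mem) (QuotMul.pushoutMap_injective h hL)
    LinearMap.id
  exact not_isSplitMono_pushoutMap h hL ⟨r, LinearMap.ext hr⟩

theorem QuotMul.not_cyclic (h : IsDPPair I K) (hL : IsPureIn I K L g)
    (m : QuotMul I L g) : ∃ m' : QuotMul I L g, ∀ a : S, m' ≠ a • m := by
  by_contra! hm
  obtain ⟨s, hs, rfl⟩ := QuotMul.exists_mk m
  have hLs : ∀ t ∈ L, ∃ a, ∃ z ∈ I, t - a * s = z * g := by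
    intro t ht
    obtain ⟨a, ha⟩ := hm (QuotMul.mk I g ht)
    rw [QuotMul.smul_mk, QuotMul.mk_eq_mk] at ha
    exact ⟨a, ha⟩
  have key : ∃ t ∈ L, t ∉ K ∧ (∃ y, s = y * t) ∧ ∃ y, g = y * t := by
    by_cases hs0 : s = 0
    · exact ⟨g, hL.mem, hL.notMem, ⟨0, by simp [hs0]⟩, 1, by simp⟩
    obtain ⟨f, k, hf, hk, rfl⟩ := h.factor s hs0
    obtain ⟨y, hy, hfy⟩ := hL.pure f k (h.mem_I_of_mul_mem hf (hL.le hs)) hs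
    obtain rfl := h.mul_left_cancel hf hfy
    rcases h.comparable y g hk hL.notMem with ⟨z, hz⟩ | ⟨z, hz⟩
    · exact ⟨g, hL.mem, hL.notMem, ⟨f * z, by rw [mul_assoc, hz]⟩, 1, by simp⟩
    · exact ⟨y, hy, hk, ⟨f, rfl⟩, z, hz⟩
  obtain ⟨t, ht, htK, ⟨y, rfl⟩, y', rfl⟩ := key
  -- Dividing the epi t by itself inside I, then inside L by purity, gives t = t w with w ∈ L. A
  -- cyclic quotient would force w = c t, hence t = t c t and 1 = t c ∈ I.
  obtain ⟨v, hv, htv⟩ := h.exists_eq_mul_mem_I htK (hL.le ht)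
  obtain ⟨w, hw, hwv⟩ := hL.pure t v hv (htv ▸ ht)
  obtain ⟨a, z, -, haz⟩ := hLs w hw
  have hwt : w = (a * y + z * y') * t := by
    rw [eq_add_of_sub_eq haz]
    noncomm_ring
  have h1 : 1 = t * (a * y + z * y') := by
    refine h.mul_right_cancel htK ?_
    rw [one_mul, mul_assoc, ← hwt, hwv, ← htv]
  exact h.one_notMem_I (h1 ▸ h.mul_mem_I t (hL.le ht) _)

/-- Since q(1) = g u, the map q already factors through sω followed by a map into S u. Minimality
makes U → L/Ig → S u ⊆ U bijective, so U is cyclic, and then so is L/Ig. -/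
theorem not_isMinimalLeftAlmostSplit (h : IsDPPair I K) (hL : IsPureIn I K L g)
    (hc : ∃ s : Set S, s.Countable ∧ Ideal.span s = L) {U : Type u} [AddCommGroup U] [Module S U]
    (q : (S ⧸ I) →ₗ[S] U) : ¬ IsMinimalLeftAlmostSplit q := by
  rintro ⟨hq, hmin⟩
  obtain ⟨k, hk⟩ := hq.2 _ _ (not_isSplitMono_pushoutMap h hL)
  obtain ⟨u, hu⟩ := mem_mulSubmodule_of_not_isSplitMono h (hL.le hL.mem) hL.notMem hq.1
  -- factor `q` through a cyclic submodule of `U`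
  let V : Submodule S U := Submodule.span S {u}
  have hqV : ∀ x, q x ∈ V := by
    intro x
    obtain ⟨x, rfl⟩ := Submodule.mkQ_surjective _ x
    have : (I.mkQ x : S ⧸ I) = x • Submodule.Quotient.mk 1 := by
      rw [← Submodule.Quotient.mk_smul, smul_eq_mul, mul_one]
      rfl
    rw [this, map_smul, hu]
    exact V.smul_mem _ (V.smul_mem _ (Submodule.subset_span rfl))
  obtain ⟨l, hl⟩ := exists_comp_pushoutMap_eq h hL hc (hL.le hL.mem) hL.notMem
    (q := q.codRestrict V hqV) ⟨⟨u, Submodule.subset_span rfl⟩, Subtype.ext hu⟩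
  let l' : QuotMul I L g →ₗ[S] U := V.subtype ∘ₗ l
  have hl' : l' ∘ₗ pushoutMap I L g hL.mem = q := by
    ext
    exact congrArg Subtype.val (LinearMap.congr_fun hl (Submodule.Quotient.mk 1))
  have hbij := hmin (l' ∘ₗ k) (by rw [LinearMap.comp_assoc, hk, hl'])
  have hU : ∀ x : U, ∃ a : S, x = a • u := by
    intro x
    obtain ⟨y, rfl⟩ := hbij.2 x
    obtain ⟨a, ha⟩ := Submodule.mem_span_singleton.1 (l (k y)).2
    exact ⟨a, ha.symm⟩
  -- The kernel of l' meets the nonzero range of k trivially, so in a uniserial module it is zero.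
  have hker : LinearMap.ker l' = ⊥ := by
    rcases QuotMul.isUniserial h hL (LinearMap.ker l') (LinearMap.range k) with h' | h'
    · refine (Submodule.eq_bot_iff _).2 fun x hx => ?_
      obtain ⟨y, rfl⟩ := h' hx
      have : y = 0 := (injective_iff_map_eq_zero (l' ∘ₗ k)).1 hbij.1 y hx
      rw [this, map_zero]
    · have hU0 : ∀ y : U, y = 0 := fun y =>
        (injective_iff_map_eq_zero (l' ∘ₗ k)).1 hbij.1 y (h' ⟨y, rfl⟩)
      have hs := QuotMul.pushoutMap_injective h hL
      have h1 : (Submodule.Quotient.mk 1 : S ⧸ I) = 0 := by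
        refine (injective_iff_map_eq_zero _).1 hs _ ?_
        rw [← hk, LinearMap.comp_apply, hU0 (q _), map_zero]
      exact absurd ((Submodule.Quotient.mk_eq_zero _).1 h1) h.one_notMem_I
  have hinj := LinearMap.ker_eq_bot.1 hker
  obtain ⟨m, hm⟩ := QuotMul.not_cyclic h hL (k u)
  obtain ⟨y, hy⟩ := hbij.2 (l' m)
  obtain ⟨a, rfl⟩ := hU y
  exact hm a (hinj (by rw [← hy, LinearMap.comp_apply, map_smul]))

end AlmostSplit

theorem IsAlmostSplitSequence.isMinimalLeftAlmostSplit {S : Type u} [Ring S] {A B C : Type v}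
    [AddCommGroup A] [Module S A] [AddCommGroup B] [Module S B] [AddCommGroup C] [Module S C]
    {i : A →ₗ[S] B} {p : B →ₗ[S] C} (h : IsAlmostSplitSequence i p) :
    IsMinimalLeftAlmostSplit i := by
  obtain ⟨hi, hip, hp, hil, hpr⟩ := h
  refine ⟨hil, fun t ht => ?_⟩
  have hti : ∀ x, t (i x) = i x := LinearMap.congr_fun ht
  have hker : LinearMap.ker p ≤ LinearMap.ker (p ∘ₗ t) := by
    intro x hx
    obtain ⟨y, rfl⟩ := (hip x).1 hx
    rw [LinearMap.mem_ker, LinearMap.comp_apply, hti]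
    exact hx
  let t' : C →ₗ[S] C := (LinearMap.ker p).liftQ (p ∘ₗ t) hker ∘ₗ
    (p.quotKerEquivOfSurjective hp).symm.toLinearMap
  have ht' : ∀ x, t' (p x) = p (t x) := by
    intro x
    have h1 : (p.quotKerEquivOfSurjective hp).symm (p x) = (LinearMap.ker p).mkQ x := by
      rw [LinearEquiv.symm_apply_eq]
      rfl
    change (LinearMap.ker p).liftQ (p ∘ₗ t) hker ((p.quotKerEquivOfSurjective hp).symm (p x)) = _
    rw [h1]
    rfl
  -- Otherwise t' = p k, and t - k p maps B into the range of i and restricts to i on A, which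
  -- splits i.
  have hsplit : IsSplitEpi t' := by
    by_contra hns
    obtain ⟨k, hk⟩ := hpr.2 _ t' hns
    have hpk : ∀ x, p (t x - k (p x)) = 0 := fun x => by
      rw [map_sub, ← ht', ← hk, LinearMap.comp_apply, sub_self]
    let d : B →ₗ[S] B := t - k ∘ₗ p
    have hd : ∀ x, d x ∈ LinearMap.range i := fun x => (hip _).1 (hpk x)
    refine hil.1 ⟨(LinearEquiv.ofInjective i hi).symm.toLinearMap ∘ₗ
      d.codRestrict (LinearMap.range i) hd, ?_⟩
    ext x
    change (LinearEquiv.ofInjective i hi).symm ⟨d (i x), hd (i x)⟩ = x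
    rw [LinearEquiv.symm_apply_eq]
    refine Subtype.ext ?_
    change t (i x) - k (p (i x)) = i x
    rw [hti, (hip (i x)).2 ⟨x, rfl⟩, map_zero, sub_zero]
  obtain ⟨c, hc⟩ := hsplit
  -- Otherwise c = p k, and p t k = t' p k = t' c = id splits p. So c has inverses on both sides, t'
  -- is bijective, and a diagram chase gives t bijective.
  have hcs : IsSplitEpi c := by
    by_contra hns
    obtain ⟨k, hk⟩ := hpr.2 _ c hns
    refine hpr.1 ⟨t ∘ₗ k, ?_⟩
    ext x
    rw [LinearMap.comp_apply, LinearMap.comp_apply, ← ht', ← LinearMap.comp_apply p k, hk]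
    exact LinearMap.congr_fun hc x
  obtain ⟨c', hc'⟩ := hcs
  have ht'inj : ∀ x, t' x = 0 → x = 0 := by
    intro x hx
    have h1 : c (c' x) = x := LinearMap.congr_fun hc' x
    have h2 : t' (c (c' x)) = c' x := LinearMap.congr_fun hc (c' x)
    rw [h1, hx] at h2
    rw [← h1, ← h2, map_zero]
  constructor
  · refine (injective_iff_map_eq_zero t).2 fun x hx => ?_
    have h1 : p x = 0 := ht'inj _ (by rw [ht', hx, map_zero])
    obtain ⟨y, rfl⟩ := (hip x).1 h1
    rw [← hti, hx]
  · intro y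
    obtain ⟨x, hx⟩ := hp (c (p y))
    have h1 : p (y - t x) = 0 := by
      have : t' (c (p y)) = p y := LinearMap.congr_fun hc (p y)
      rw [map_sub, ← ht', hx, this, sub_self]
    obtain ⟨z, hz⟩ := (hip _).1 h1
    exact ⟨x + i z, by rw [map_add, hti, hz, add_sub_cancel]⟩

/-! ### Construction of Iω -/

section Existence

variable {S : Type u} [Ring S] {I K : Ideal S} {f g : S}

/-- One step of a closing-off argument: absorbing t f keeps Iω f inside Iω, and absorbing z with f t
= z f makes every element of Jω a multiple of f from within Jω. The factor x ∈ I serves purity. -/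
theorem IsDPPair.exists_next (h : IsDPPair I K) (hf : f ∈ K) (hf' : f ∉ I) {t : S} (ht : t ∈ I) :
    ∃ t' ∈ I, t' ∉ K ∧ (∃ x ∈ I, t = x * t') ∧ (∃ y, t * f = y * t') ∧
      ∃ z ∈ I, z ∈ K ∧ f * t = z * f ∧ ∃ w, z = w * t' := by
  obtain ⟨z, hz, hzK, hzf⟩ := h.exists_eq_mul_mem_J hf hf' (I.mul_mem_left f ht)
    (h.mul_mem_K f hf t)
  obtain ⟨t₁, ht₁, -, ⟨x, hx, htx⟩, y, -, hty⟩ := h.exists_common_epi ht (h.mul_mem_I t ht f)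
  obtain ⟨t', ht', htK, ⟨x', -, htx'⟩, w, -, hzw⟩ := h.exists_common_epi ht₁ hz
  exact ⟨t', ht', htK, ⟨x * x', h.mul_mem_I x hx x', by rw [htx, htx', mul_assoc]⟩,
    ⟨y * x', by rw [hty, htx', mul_assoc]⟩, z, hz, hzK, hzf, w, hzw⟩

theorem IsDPPair.exists_chain (h : IsDPPair I K) (hf : f ∈ K) (hf' : f ∉ I) (hg : g ∈ I)
    (hgK : g ∉ K) :
    ∃ t : ℕ → S, t 0 = g ∧ (∀ k, t k ∈ I) ∧ (∀ k, t k ∉ K) ∧ (∀ k, ∃ x ∈ I, t k = x * t (k + 1)) ∧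
      (∀ k, ∃ y, t k * f = y * t (k + 1)) ∧
      ∀ k, ∃ z ∈ I, z ∈ K ∧ f * t k = z * f ∧ ∃ w, z = w * t (k + 1) := by
  choose! next h₁ h₂ h₃ h₄ h₅ using fun (t : S) (ht : t ∈ I) => h.exists_next hf hf' ht
  let t : ℕ → S := fun k => Nat.rec g (fun _ => next) k
  have ht : ∀ k, t k ∈ I ∧ t k ∉ K := by
    intro k
    induction k with
    | zero => exact ⟨hg, hgK⟩
    | succ k ih => exact ⟨h₁ _ ih.1, h₂ _ ih.1⟩
  exact ⟨t, rfl, fun k => (ht k).1, fun k => (ht k).2, fun k => h₃ _ (ht k).1,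
    fun k => h₄ _ (ht k).1, fun k => h₅ _ (ht k).1⟩

theorem mem_span_range_of_chain {t : ℕ → S} (hx : ∀ k, ∃ x ∈ I, t k = x * t (k + 1)) {s : S} :
    s ∈ Ideal.span (Set.range t) ↔ ∃ k y, s = y * t k := by
  have mono : ∀ k m, ∃ y, t k = y * t (k + m) := by
    intro k m
    induction m with
    | zero => exact ⟨1, by simp⟩
    | succ m ih =>
      obtain ⟨y, hy⟩ := ih
      obtain ⟨x, -, hx⟩ := hx (k + m)
      exact ⟨y * x, by rw [hy, mul_assoc]; exact congrArg _ hx⟩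
  constructor
  · intro hs
    induction hs using Submodule.span_induction with
    | mem a ha =>
      obtain ⟨k, rfl⟩ := ha
      exact ⟨k, 1, by simp⟩
    | zero => exact ⟨0, 0, by simp⟩
    | add a b _ _ ha hb =>
      obtain ⟨n, y, rfl⟩ := ha
      obtain ⟨m, z, rfl⟩ := hb
      obtain ⟨c, hc⟩ := mono n m
      obtain ⟨d, hd⟩ := mono m n
      rw [add_comm m n] at hd
      refine ⟨n + m, y * c + z * d, ?_⟩
      rw [add_mul, mul_assoc, mul_assoc, ← hc, ← hd]
    | smul r a _ ha =>
      obtain ⟨n, y, rfl⟩ := ha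
      exact ⟨n, r * y, by rw [smul_eq_mul, mul_assoc]⟩
  · rintro ⟨k, y, rfl⟩
    exact Ideal.mul_mem_left _ _ (Ideal.subset_span ⟨k, rfl⟩)

theorem isPure_span_range_of_chain (h : IsDPPair I K) {t : ℕ → S} (htI : ∀ k, t k ∈ I)
    (htK : ∀ k, t k ∉ K) (hx : ∀ k, ∃ x ∈ I, t k = x * t (k + 1)) :
    IsPure ((Ideal.span (Set.range t)).submoduleOf I) := by
  intro G _ _ hG φ
  obtain ⟨n, A, e, hA⟩ := Module.FinitePresentation.exists_fin S G
  let L : Ideal S := Ideal.span (Set.range t)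
  let N : Submodule S I := L.submoduleOf I
  obtain ⟨Z, hZ⟩ := Module.projective_lifting_property N.mkQ (φ ∘ₗ e.symm.toLinearMap ∘ₗ A.mkQ)
    N.mkQ_surjective
  have hZA : ∀ a ∈ A, (Z a : S) ∈ L := by
    intro a ha
    have h1 : N.mkQ (Z a) = 0 := by
      refine (LinearMap.congr_fun hZ a).trans ?_
      change φ (e.symm (A.mkQ a)) = 0
      rw [Submodule.mkQ_apply, (Submodule.Quotient.mk_eq_zero A).2 ha, map_zero, map_zero]
    exact (Submodule.Quotient.mk_eq_zero N).1 h1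
  -- it suffices to correct `Z` by a map into `L` that agrees with `Z` on `A`
  suffices hY : ∃ Y : (Fin n → S) →ₗ[S] S, (∀ y, Y y ∈ L) ∧ ∀ a ∈ A, Y a = Z a by
    obtain ⟨Y, hYL, hYA⟩ := hY
    have hLI : L ≤ I := Ideal.span_le.2 (by rintro _ ⟨k, rfl⟩; exact htI k)
    let Y' : (Fin n → S) →ₗ[S] I := Y.codRestrict I fun y => hLI (hYL y)
    have hW : A ≤ LinearMap.ker (Z - Y') := fun a ha => by
      rw [LinearMap.mem_ker, LinearMap.sub_apply, sub_eq_zero]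
      exact Subtype.ext (hYA a ha).symm
    refine ⟨A.liftQ (Z - Y') hW ∘ₗ e.toLinearMap, ?_⟩
    ext γ
    obtain ⟨q, rfl⟩ := e.symm.surjective γ
    obtain ⟨y, rfl⟩ := A.mkQ_surjective q
    have h1 : N.mkQ (Y' y) = 0 := (Submodule.Quotient.mk_eq_zero N).2 (hYL y)
    have h2 : N.mkQ (Z y) = φ (e.symm (A.mkQ y)) := LinearMap.congr_fun hZ y
    change N.mkQ (A.liftQ (Z - Y') hW (e (e.symm (A.mkQ y)))) = φ (e.symm (A.mkQ y))
    rw [e.apply_symm_apply, Submodule.mkQ_apply A, Submodule.liftQ_apply, LinearMap.sub_apply,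
      map_sub, h1, sub_zero, h2]
    rfl
  let Z₀ : (Fin n → S) →ₗ[S] S := I.subtype ∘ₗ Z
  obtain ⟨d, hd⟩ := exists_eq_span_singleton_of_fg h.exists_generator
    (Module.Finite.fg_top.map Z₀ : ((⊤ : Submodule S (Fin n → S)).map Z₀).FG)
  obtain ⟨d', hd'⟩ := exists_eq_span_singleton_of_fg h.exists_generator (hA.map Z₀)
  have hdI : d ∈ I := by
    have : d ∈ (⊤ : Submodule S (Fin n → S)).map Z₀ := hd ▸ Ideal.subset_span rfl
    obtain ⟨y, -, rfl⟩ := this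
    exact (Z y).2
  have hdL : d' ∈ L := by
    have : d' ∈ A.map Z₀ := hd' ▸ Ideal.subset_span rfl
    obtain ⟨a, ha, rfl⟩ := this
    exact hZA a ha
  obtain ⟨r, -, hrK, c, -, hc⟩ := h.exists_eq_mul_epi hdI
  obtain ⟨k, c', hc'⟩ := (mem_span_range_of_chain hx).1 hdL
  have hZr : ∀ y, ∃ b, Z₀ y = b * r := by
    intro y
    have : Z₀ y ∈ (⊤ : Submodule S (Fin n → S)).map Z₀ := ⟨y, Submodule.mem_top, rfl⟩
    rw [hd] at this
    obtain ⟨b, hb⟩ := Ideal.mem_span_singleton'.1 this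
    exact ⟨b * c, by rw [← hb, hc, mul_assoc]⟩
  have hZt : ∀ a ∈ A, ∃ b, Z₀ a = b * t k := by
    intro a ha
    have : Z₀ a ∈ A.map Z₀ := ⟨a, ha, rfl⟩
    rw [hd'] at this
    obtain ⟨b, hb⟩ := Ideal.mem_span_singleton'.1 this
    exact ⟨b * c', by rw [← hb, hc', mul_assoc]⟩
  have htL : ∀ k, t k ∈ L := fun k => Ideal.subset_span ⟨k, rfl⟩
  have trivial_case : r ∈ L → ∃ Y : (Fin n → S) →ₗ[S] S, (∀ y, Y y ∈ L) ∧ ∀ a ∈ A, Y a = Z a := by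
    intro hr
    refine ⟨Z₀, fun y => ?_, fun a _ => rfl⟩
    obtain ⟨b, hb⟩ := hZr y
    exact hb ▸ L.mul_mem_left b hr
  rcases h.comparable r (t (k + 1)) hrK (htK _) with ⟨y, hy⟩ | ⟨p, hp⟩
  · exact trivial_case (hy ▸ L.mul_mem_left y (htL _))
  have hpK : p ∉ K := fun hp' => htK (k + 1) (hp ▸ h.mul_mem_K p hp' r)
  by_cases hpI : p ∈ I
  swap
  · obtain ⟨p, rfl⟩ := h.isUnit p hpI hpK
    refine trivial_case ?_
    have : r = ↑p⁻¹ * t (k + 1) := by rw [hp, Units.inv_mul_cancel_left]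
    exact this ▸ L.mul_mem_left _ (htL _)
  obtain ⟨x, hxI, hxt⟩ := hx k
  have hxK : x ∉ K := fun hx' => htK k (hxt ▸ h.mul_mem_K x hx' _)
  -- With m the kernel of x, v = m + p is a unit and x v = x p. So replacing r = p⁻¹ t_{k+1}, were p
  -- invertible, by v⁻¹ t_{k+1} ∈ L leaves multiples of x p r = t_k unchanged.
  obtain ⟨m, hm, hmI, hmx⟩ := h.exists_left x hxI hxK
  obtain ⟨v, hv⟩ := h.isUnit_add hm hmI hpI hpK
  have hxv : x * p * ↑v⁻¹ = x := by
    rw [Units.mul_inv_eq_iff_eq_mul, hv, mul_add, hmx.mul_eq_zero, zero_add]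
  obtain ⟨Z', hZ'⟩ := Module.projective_lifting_property (rightMul r).rangeRestrict
    (Z₀.codRestrict (LinearMap.range (rightMul r)) fun y => by
      obtain ⟨b, hb⟩ := hZr y
      exact ⟨b, hb.symm⟩) (LinearMap.surjective_rangeRestrict _)
  have hZ'r : ∀ y, Z' y * r = Z₀ y := fun y => congrArg Subtype.val (LinearMap.congr_fun hZ' y)
  refine ⟨rightMul (↑v⁻¹ * t (k + 1)) ∘ₗ Z', fun y => ?_, fun a ha => ?_⟩
  · exact L.mul_mem_left (Z' y) (L.mul_mem_left _ (htL _))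
  · obtain ⟨b, hb⟩ := hZt a ha
    have h1 : Z' a = b * x * p := by
      refine h.mul_right_cancel hrK ?_
      rw [hZ'r, hb, hxt, hp]
      simp only [mul_assoc]
    have h2 : Z' a * (↑v⁻¹ * t (k + 1)) = b * (x * p * ↑v⁻¹) * t (k + 1) := by
      rw [h1]
      simp only [mul_assoc]
    refine h2.trans ?_
    rw [hxv, mul_assoc, ← hxt, ← hb]
    rfl

end Existence

/-! ### Existence and purity of Iω in the endomorphism ring -/

section Main

variable {R : Type u} [Ring R] {X : Type v} [AddCommGroup X] [Module Rᵐᵒᵖ X]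

theorem IsShortExact.exists_isOmega {f g : Module.End Rᵐᵒᵖ X} (hfg : IsShortExact f g)
    (hR : IsNearlySimpleUniserialDomain R) (hX : IsCyclicallyPresentedTorsion R X) :
    ∃ Iω : Ideal (Module.End Rᵐᵒᵖ X), IsOmega hR hX f g Iω := by
  have h := isDPPair hR hX
  have hf := hfg.left_mem_K hR hX
  have hf' := hfg.left_notMem_I hR hX
  obtain ⟨t, ht0, htI, htK, hx, hy, hz⟩ := h.exists_chain hf hf' (hfg.right_mem_I hR hX)
    (hfg.right_notMem_K hR hX)
  have htL : ∀ k, t k ∈ Ideal.span (Set.range t) := fun k => Ideal.subset_span ⟨k, rfl⟩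
  have hLI : Ideal.span (Set.range t) ≤ idealI hR hX :=
    Ideal.span_le.2 (by rintro _ ⟨k, rfl⟩; exact htI k)
  have h₁ : Submodule.map (rightMul f) (Ideal.span (Set.range t)) ≤
      Ideal.span (Set.range t) ⊓ idealJ hR hX := by
    rintro _ ⟨s, hs, rfl⟩
    obtain ⟨k, y, rfl⟩ := (mem_span_range_of_chain hx).1 hs
    refine ⟨?_, h.mul_mem_I _ (hLI hs) f, Ideal.mul_mem_left _ (y * t k) hf⟩
    obtain ⟨w, hw⟩ := hy k
    change y * t k * f ∈ Ideal.span (Set.range t)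
    rw [mul_assoc, hw]
    exact Ideal.mul_mem_left _ _ (Ideal.mul_mem_left _ _ (htL _))
  have h₂ : Submodule.map (rightMul f) (Ideal.span (Set.range t) ⊓ idealJ hR hX) ≤
      Submodule.map (rightMul f) (Ideal.span (Set.range t)) := Submodule.map_mono inf_le_left
  have h₃ : Ideal.span (Set.range t) ⊓ idealJ hR hX ≤
      Submodule.map (rightMul f) (Ideal.span (Set.range t) ⊓ idealJ hR hX) := by
    rintro s ⟨hs, -, hsK⟩
    obtain ⟨k, y, rfl⟩ := (mem_span_range_of_chain hx).1 hs
    -- As t_k is epi, y t_k ∈ K forces y ∈ K, so y = y' f; then y' f t_k = y' z f with z in Jω.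
    have hyK : y ∈ idealK hR hX := by
      by_contra hyK
      exact h.prime_K _ _ hyK (htK k) hsK
    obtain ⟨y', rfl⟩ := h.eq_mul_of_mem_K f hf' y hyK
    obtain ⟨z, hzI, hzK, hzf, w, hw⟩ := hz k
    refine ⟨y' * z, ⟨?_, Ideal.mul_mem_left _ _ hzI, Ideal.mul_mem_left _ _ hzK⟩, ?_⟩
    · rw [hw]
      exact Ideal.mul_mem_left _ _ (Ideal.mul_mem_left _ _ (htL _))
    · change y' * z * f = y' * f * t k
      rw [mul_assoc, mul_assoc, hzf]
  refine ⟨Ideal.span (Set.range t), hLI, ⟨_, Set.countable_range t, rfl⟩,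
    isPure_span_range_of_chain h htI htK hx, ?_, le_antisymm h₁ (h₃.trans h₂),
    le_antisymm (h₂.trans h₁) h₃⟩
  exact (Ideal.span_singleton_le_iff_mem _).2 (ht0 ▸ htL 0)

theorem IsOmega.isPureIn {hR : IsNearlySimpleUniserialDomain R}
    {hX : IsCyclicallyPresentedTorsion R X} {f g : Module.End Rᵐᵒᵖ X}
    {Iω : Ideal (Module.End Rᵐᵒᵖ X)} (hω : IsOmega hR hX f g Iω) (hfg : IsShortExact f g) :
    IsPureIn (idealI hR hX) (idealK hR hX) Iω g where
  le := hω.le_I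
  mem := hω.g_mem
  notMem := hfg.right_notMem_K hR hX
  pure _ _ hx hbx := hω.pure.exists_mul_eq hx hbx

end Main

end DubrovinPuninski

theorem propositionA17 {R : Type u} [Ring R]
    (hR : DubrovinPuninski.IsNearlySimpleUniserialDomain R)
    {X : Type v} [AddCommGroup X] [Module Rᵐᵒᵖ X]
    (hX : DubrovinPuninski.IsCyclicallyPresentedTorsion R X) :
    -- the data exist
    (∃ f g : Module.End Rᵐᵒᵖ X, DubrovinPuninski.IsShortExact f g) ∧
    (∀ f g : Module.End Rᵐᵒᵖ X, DubrovinPuninski.IsShortExact f g →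
      ∃ Iω : Ideal (Module.End Rᵐᵒᵖ X), DubrovinPuninski.IsOmega hR hX f g Iω) ∧
    -- properties of `Iω / I g` and of `sω`
    (∀ f g : Module.End Rᵐᵒᵖ X, DubrovinPuninski.IsShortExact f g →
      ∀ (Iω : Ideal (Module.End Rᵐᵒᵖ X)) (hω : DubrovinPuninski.IsOmega hR hX f g Iω),
        DubrovinPuninski.IsAbsolutelyPure (Module.End Rᵐᵒᵖ X)
          (DubrovinPuninski.IomegaModIg hR hX g Iω) ∧
        DubrovinPuninski.IsFlat (Module.End Rᵐᵒᵖ X)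
          (DubrovinPuninski.IomegaModIg hR hX g Iω) ∧
        DubrovinPuninski.IsUniserial (Module.End Rᵐᵒᵖ X)
          (DubrovinPuninski.IomegaModIg hR hX g Iω) ∧
        Function.Injective (DubrovinPuninski.sOmega hω) ∧
        LinearMap.range (DubrovinPuninski.sOmega hω) =
          DubrovinPuninski.socle (Module.End Rᵐᵒᵖ X)
            (DubrovinPuninski.IomegaModIg hR hX g Iω) ∧
        DubrovinPuninski.IsLeftAlmostSplit (DubrovinPuninski.sOmega hω)) ∧
    -- `S / I` is simple and not injective
    IsSimpleModule (Module.End Rᵐᵒᵖ X)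
      (Module.End Rᵐᵒᵖ X ⧸ DubrovinPuninski.idealI hR hX) ∧
    ¬ Module.Injective (Module.End Rᵐᵒᵖ X)
      (Module.End Rᵐᵒᵖ X ⧸ DubrovinPuninski.idealI hR hX) ∧
    -- no minimal left almost split morphism starts at `S / I`
    (∀ (U : Type v) [AddCommGroup U] [Module (Module.End Rᵐᵒᵖ X) U]
      (q : (Module.End Rᵐᵒᵖ X ⧸ DubrovinPuninski.idealI hR hX) →ₗ[Module.End Rᵐᵒᵖ X] U),
      ¬ DubrovinPuninski.IsMinimalLeftAlmostSplit q) ∧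
    -- no almost split sequence starts at `S / I`
    (∀ (B C : Type v) [AddCommGroup B] [Module (Module.End Rᵐᵒᵖ X) B]
      [AddCommGroup C] [Module (Module.End Rᵐᵒᵖ X) C]
      (i : (Module.End Rᵐᵒᵖ X ⧸ DubrovinPuninski.idealI hR hX) →ₗ[Module.End Rᵐᵒᵖ X] B)
      (p : B →ₗ[Module.End Rᵐᵒᵖ X] C),
      ¬ DubrovinPuninski.IsAlmostSplitSequence i p) := by
  have h := DubrovinPuninski.isDPPair hR hX
  obtain ⟨f, g, hfg⟩ := DubrovinPuninski.exists_isShortExact hR hX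
  obtain ⟨Iω, hω⟩ := hfg.exists_isOmega hR hX
  have hL := hω.isPureIn hfg
  refine ⟨⟨f, g, hfg⟩, fun f g hfg => hfg.exists_isOmega hR hX, fun f g hfg Iω hω => ?_,
    h.isSimpleModule, DubrovinPuninski.not_injective_quotient h hL,
    fun U _ _ q => DubrovinPuninski.not_isMinimalLeftAlmostSplit h hL hω.countablyGenerated q,
    fun B C _ _ _ _ i p hip => DubrovinPuninski.not_isMinimalLeftAlmostSplit h hL
      hω.countablyGenerated i hip.isMinimalLeftAlmostSplit⟩
  have hL := hω.isPureIn hfg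
  have huni := DubrovinPuninski.QuotMul.isUniserial h hL
  have hinj := DubrovinPuninski.QuotMul.pushoutMap_injective h hL
  exact ⟨DubrovinPuninski.QuotMul.isAbsolutelyPure h hL, DubrovinPuninski.QuotMul.isFlat h hL,
    huni, hinj, DubrovinPuninski.range_eq_socle h.isSimpleModule huni hinj,
    DubrovinPuninski.isLeftAlmostSplit_pushoutMap h hL hω.countablyGenerated⟩
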